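/- Let $0<h_1\le h_2$ and let $\tilde T\subset\mathbb{R}^2$ be the triangle with vertices $\tilde z_1=(0,h_2)$, $\tilde z_2=(h_1,0)$, $\tilde z_3=(0,0)$. Let $\tilde z_0$ be an arbitrary interior point of $\tilde T$ (the split point), and let $\tilde T^{ct}=\{\tilde K_1,\tilde K_2,\tilde K_3\}$ be the partition of $\tilde T$ into the three triangles obtained by connecting $\tilde z_0$ to the vertices of $\tilde T$. Let $\mathring{\boldsymbol{P}}{}_2^c(\tilde T^{ct})$ be the space of continuous vector fields $\tilde w:\tilde T\to\mathbb{R}^2$ that vanish on $\partial\tilde T$ and whose components are polynomials of degree at most $2$ on each $\tilde K_i$. Let $\tilde\mu$ be the hat function of the split point, i.e. the continuous function on $\tilde T$ that is affine on each $\tilde K_i$, vanishes on $\partial \tilde T$ and satisfies $\tilde\mu(\tilde z_0)=1$. Put $\tilde\varrho=h_2/h_1$, and let $|\cdot|_{H^1(\tilde T)}$ denote the $H^1$ seminorm (the $L^2(\tilde T)$ norm of the gradient). Theorem. There are constants $C,c>0$, independent of $h_1$, $h_2$ and the split point $\tilde z_0$, such that for all $\tilde w\in\mathring{\boldsymbol{P}}{}_2^c(\tilde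 T^{ct})$ \[ |\tilde w|_{H^1(\tilde T)}\le C\,\tilde\varrho^{1/2}\bigl(1+|\tilde\mu|_{H^1(\tilde T)}\bigr)\,\|\operatorname{div}\tilde w\|_{L^2(\tilde T)}. \] In particular, there is a largest constant $\beta>0$ such that $|\tilde w|_{H^1(\tilde T)}\le\beta^{-1}\|\operatorname{div}\tilde w\|_{L^2(\tilde T)}$ for all $\tilde w\in\mathring{\boldsymbol{P}}{}_2^c(\tilde T^{ct})$ (the local inf-sup constant $\beta_{\tilde T^{ct}}$), and it satisfies \[ \beta_{\tilde T^{ct}}\ge c\,\Bigl(\tilde\varrho^{1/2}\bigl(1+|\tilde\mu|_{H^1(\tilde T)}\bigr)\Bigr)^{-1}. \] -/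

import Mathlib

noncomputable section

namespace CloughTocher

/-- The closed triangle with vertices `z 0`, `z 1`, `z 2`. -/
def triangle (z : Fin 3 → ℝ × ℝ) : Set (ℝ × ℝ) :=
  convexHull ℝ (Set.range z)

/-- The `i`-th closed subtriangle of the Clough-Tocher split of `triangle z` at `z₀`: the vertex
`z i` is replaced by `z₀`, so this subtriangle contains the edge opposite to `z i`. -/
def cell (z : Fin 3 → ℝ × ℝ) (z₀ : ℝ × ℝ) (i : Fin 3) : Set (ℝ × ℝ) :=
  convexHull ℝ (insert z₀ (z '' {i}ᶜ))

/-- On the set `K`, the function `f` is a polynomial in two variables of total degree at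
most `k`. -/
def IsPolyOn (k : ℕ) (K : Set (ℝ × ℝ)) (f : ℝ × ℝ → ℝ) : Prop :=
  ∃ p : MvPolynomial (Fin 2) ℝ, p.totalDegree ≤ k ∧
    ∀ x ∈ K, f x = MvPolynomial.eval ![x.1, x.2] p

/-- The continuous piecewise `P_k` functions on the Clough-Tocher split of `triangle z` at `z₀`
that vanish on the boundary. Only the values on `triangle z` matter. -/
def scalarSpace (k : ℕ) (z : Fin 3 → ℝ × ℝ) (z₀ : ℝ × ℝ) : Set (ℝ × ℝ → ℝ) :=
  {f | ContinuousOn f (triangle z) ∧ (∀ x ∈ frontier (triangle z), f x = 0) ∧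
    ∀ i, IsPolyOn k (cell z z₀ i) f}

/-- The vector fields both of whose components lie in `scalarSpace k z z₀`. -/
def vectorSpace (k : ℕ) (z : Fin 3 → ℝ × ℝ) (z₀ : ℝ × ℝ) : Set (ℝ × ℝ → ℝ × ℝ) :=
  {w | (fun x => (w x).1) ∈ scalarSpace k z z₀ ∧ (fun x => (w x).2) ∈ scalarSpace k z z₀}

/-- `μ` is the hat function of the split point: the continuous piecewise affine function which
vanishes on the boundary of the triangle and equals one at `z₀`. -/
def IsHatFunction (z : Fin 3 → ℝ × ℝ) (z₀ : ℝ × ℝ) (μ : ℝ × ℝ → ℝ) : Prop :=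
  μ ∈ scalarSpace 1 z z₀ ∧ μ z₀ = 1

/-- First partial derivative. Continuous piecewise polynomials are differentiable off the edges of
the split, a null set, and there this derivative is their weak derivative. -/
def dx (f : ℝ × ℝ → ℝ) (x : ℝ × ℝ) : ℝ := fderiv ℝ f x (1, 0)

/-- Second partial derivative. -/
def dy (f : ℝ × ℝ → ℝ) (x : ℝ × ℝ) : ℝ := fderiv ℝ f x (0, 1)

/-- The divergence of a planar vector field. -/
def divergence (w : ℝ × ℝ → ℝ × ℝ) (x : ℝ × ℝ) : ℝ :=
  dx (fun y => (w y).1) x + dy (fun y => (w y).2) x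

/-- The `L²` norm of a scalar function on `D`. -/
def l2Norm (D : Set (ℝ × ℝ)) (f : ℝ × ℝ → ℝ) : ℝ :=
  Real.sqrt (∫ x in D, f x ^ 2)

/-- The `H¹` seminorm of a scalar function on `D`. -/
def h1Seminorm (D : Set (ℝ × ℝ)) (f : ℝ × ℝ → ℝ) : ℝ :=
  Real.sqrt (∫ x in D, (dx f x ^ 2 + dy f x ^ 2))

/-- The `H¹` seminorm of a vector field on `D`. -/
def h1SeminormVec (D : Set (ℝ × ℝ)) (w : ℝ × ℝ → ℝ × ℝ) : ℝ :=
  Real.sqrt (h1Seminorm D (fun y => (w y).1) ^ 2 + h1Seminorm D (fun y => (w y).2) ^ 2)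

/-- The admissible local stability constants: those `b > 0` for which
`|w|_{H¹} ≤ b⁻¹ ‖div w‖_{L²}` for all continuous piecewise quadratic fields `w` vanishing on the
boundary. -/
def stabilityConstants (z : Fin 3 → ℝ × ℝ) (z₀ : ℝ × ℝ) : Set ℝ :=
  {b | 0 < b ∧ ∀ w ∈ vectorSpace 2 z z₀,
    h1SeminormVec (interior (triangle z)) w ≤
      b⁻¹ * l2Norm (interior (triangle z)) (divergence w)}

/-- The local inf-sup constant: the largest admissible stability constant. -/
def localInfSup (z : Fin 3 → ℝ × ℝ) (z₀ : ℝ × ℝ) : ℝ := sSup (stabilityConstants z z₀)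

/-- The vertices `(0, h₂)`, `(h₁, 0)`, `(0, 0)` of the scaled reference triangle. -/
def refVertices (h₁ h₂ : ℝ) : Fin 3 → ℝ × ℝ := ![(0, h₂), (h₁, 0), (0, 0)]

/-- The open scaled reference triangle. -/
def refDomain (h₁ h₂ : ℝ) : Set (ℝ × ℝ) := interior (triangle (refVertices h₁ h₂))

end CloughTocher

end

/-! Write `λ_i` for the barycentric coordinates of the triangle. On cell `i` the hat function is `μ
= λ_i / λ_i(z₀)`, and a piecewise quadratic that vanishes on the boundary is `μ` times an affine
function there (`eq_on_openCell`). It is therefore fixed by four numbers: its value `A` at `z₀` and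
one coefficient `B j` for each interior edge, shared by the two cells along that edge.

At a boundary vertex `μ = 0`, so the divergence seen from cell `i` is the coefficient vector at that
vertex dotted with `∇λ_i / λ_i(z₀)`. Each vertex belongs to two cells, whose gradients `∇λ_i` are
independent, so the two values determine the vector. The values at `z₀` then determine the field
there. After the first component is scaled by `h₁` and the second by `h₂`, these equations no longer
depend on the triangle, and every coefficient is at most a multiple of `h₁` or `h₂` times a size `s`
read off from the divergence (`coefficients_le`). The `L²` norm of the divergence controls `s`
uniformly in `z₀` (`sq_le_vertexEnergy`).

Conversely, the energy of a function with coefficients of size `t` is at most a multiple of `t²`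
times the energy of `μ`, direction by direction (`sum_massForm_derivValues_le`). Taking `t = h₁ s`
and `t = h₂ s`, with `h₁ ≤ h₂`, leaves a factor `h₂²`; the energy of `μ` carries an area factor `h₁
h₂`, and the quotient is `h₂ / h₁`. This bounds the field by `|μ|` alone, which is stronger than `1
+ |μ|`.

All norms are computed exactly: derivatives are affine on each cell, so their squares integrate to
the form `massForm` of their vertex values. -/

namespace CloughTocher

open MeasureTheory

variable {h₁ h₂ : ℝ} {z₀ : ℝ × ℝ}

/-! ### Integrals over the unit simplex -/

/-- The open reference simplex. -/
def unitSimplex : Set (ℝ × ℝ) := {p | 0 < p.1 ∧ 0 < p.2 ∧ 0 < 1 - p.1 - p.2}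

lemma isOpen_unitSimplex : IsOpen unitSimplex :=
  (isOpen_lt continuous_const continuous_fst).inter
    ((isOpen_lt continuous_const continuous_snd).inter
      (isOpen_lt continuous_const ((continuous_const.sub continuous_fst).sub continuous_snd)))

lemma unitSimplex_subset : unitSimplex ⊆ Set.Icc (0 : ℝ) 1 ×ˢ Set.Icc (0 : ℝ) 1 := by
  rintro ⟨s, t⟩ ⟨h1, h2, h3⟩
  simp only at h1 h2 h3
  refine ⟨⟨?_, ?_⟩, ⟨?_, ?_⟩⟩ <;> simp only <;> linarith

lemma integrableOn_unitSimplex {f : ℝ × ℝ → ℝ} (hf : Continuous f) :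
    IntegrableOn f unitSimplex :=
  (hf.continuousOn.integrableOn_compact (isCompact_Icc.prod isCompact_Icc)).mono_set
    unitSimplex_subset

lemma setIntegral_unitSimplex {f : ℝ × ℝ → ℝ} (hf : Continuous f) :
    ∫ p in unitSimplex, f p = ∫ s in (0 : ℝ)..1, ∫ t in (0 : ℝ)..(1 - s), f (s, t) := by
  have hm := isOpen_unitSimplex.measurableSet
  rw [← integral_indicator hm, Measure.volume_eq_prod, integral_prod _
    ((integrable_indicator_iff hm).2 (integrableOn_unitSimplex hf)),
    intervalIntegral.integral_of_le zero_le_one, integral_Ioc_eq_integral_Ioo,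
    ← integral_indicator measurableSet_Ioo]
  refine integral_congr_ae (Filter.Eventually.of_forall fun s => ?_)
  by_cases hs : s ∈ Set.Ioo (0 : ℝ) 1
  · simp only [Set.indicator_of_mem hs]
    rw [intervalIntegral.integral_of_le (by linarith [hs.2]), integral_Ioc_eq_integral_Ioo,
      ← integral_indicator measurableSet_Ioo]
    refine integral_congr_ae (Filter.Eventually.of_forall fun t => ?_)
    classical
    simp only [Set.indicator_apply]
    refine if_congr ?_ rfl rfl
    simp only [unitSimplex, Set.mem_ofPred_eq, Set.mem_Ioo]
    exact ⟨fun h => ⟨h.2.1, by linarith [h.2.2]⟩, fun h => ⟨hs.1, h.1, by linarith [h.2]⟩⟩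
  · simp only [Set.indicator_of_notMem hs]
    rw [← integral_zero ℝ ℝ (μ := volume)]
    refine integral_congr_ae (Filter.Eventually.of_forall fun t => ?_)
    refine Set.indicator_of_notMem (fun h => hs ⟨h.1, ?_⟩) _
    have h1 := h.2.1
    have h2 := h.2.2
    simp only at h1 h2
    linarith

/-- The mass matrix of a triangle, up to scaling, as a quadratic form in the vertex values of an
affine function. -/
def massForm (a b c : ℝ) : ℝ := a ^ 2 + b ^ 2 + c ^ 2 + a * b + b * c + c * a

lemma integral_sq_unitSimplex (a b c : ℝ) :
    ∫ p in unitSimplex, (a * (1 - p.1 - p.2) + b * p.1 + c * p.2) ^ 2 = massForm a b c / 12 := by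
  rw [setIntegral_unitSimplex (by fun_prop)]
  have inner : ∀ s : ℝ, ∫ t in (0 : ℝ)..(1 - s), (a * (1 - s - t) + b * s + c * t) ^ 2
      = (a * (1 - s) + b * s) ^ 2 * (1 - s) + (a * (1 - s) + b * s) * (c - a) * (1 - s) ^ 2
        + (c - a) ^ 2 * (1 - s) ^ 3 / 3 := by
    intro s
    have : ∀ t : ℝ, (a * (1 - s - t) + b * s + c * t) ^ 2 = (a * (1 - s) + b * s) ^ 2
      + (2 * (a * (1 - s) + b * s) * (c - a)) * t ^ 1 + (c - a) ^ 2 * t ^ 2 := fun t => by ring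
    simp only [this]
    rw [intervalIntegral.integral_add (by apply Continuous.intervalIntegrable; fun_prop)
      (by apply Continuous.intervalIntegrable; fun_prop), intervalIntegral.integral_add
      (by apply Continuous.intervalIntegrable; fun_prop)
      (by apply Continuous.intervalIntegrable; fun_prop), intervalIntegral.integral_const,
      intervalIntegral.integral_const_mul, intervalIntegral.integral_const_mul,
      integral_pow, integral_pow]
    norm_num
    ring
  simp only [inner]
  have : ∀ s : ℝ, (a * (1 - s) + b * s) ^ 2 * (1 - s) +
        (a * (1 - s) + b * s) * (c - a) * (1 - s) ^ 2 + (c - a) ^ 2 * (1 - s) ^ 3 / 3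
      = (a ^ 2 + a * (c - a) + (c - a) ^ 2 / 3)
        + (2 * a * (b - a) - a ^ 2 + (b - a) * (c - a) - 2 * a * (c - a) - (c - a) ^ 2) * s ^ 1
        + ((b - a) ^ 2 - 2 * a * (b - a) + a * (c - a) - 2 * (b - a) * (c - a) + (c - a) ^ 2)
          * s ^ 2
        + ((b - a) * (c - a) - (b - a) ^ 2 - (c - a) ^ 2 / 3) * s ^ 3 := fun s => by ring
  simp only [this]
  rw [intervalIntegral.integral_add (by apply Continuous.intervalIntegrable; fun_prop)
      (by apply Continuous.intervalIntegrable; fun_prop), intervalIntegral.integral_add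
      (by apply Continuous.intervalIntegrable; fun_prop)
      (by apply Continuous.intervalIntegrable; fun_prop), intervalIntegral.integral_add
      (by apply Continuous.intervalIntegrable; fun_prop)
      (by apply Continuous.intervalIntegrable; fun_prop), intervalIntegral.integral_const,
      intervalIntegral.integral_const_mul, intervalIntegral.integral_const_mul,
      intervalIntegral.integral_const_mul, integral_pow, integral_pow, integral_pow]
  norm_num [massForm]
  ring

/-! ### Affine changes of variables and null lines -/

/-- The affine self-map of the plane with the given coefficients. -/
def affineMap (u v : Fin 3 → ℝ) (x : ℝ × ℝ) : ℝ × ℝ :=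
  (u 0 + u 1 * x.1 + u 2 * x.2, v 0 + v 1 * x.1 + v 2 * x.2)

/-- The derivative of `affineMap u v`. -/
noncomputable def affineMapDeriv (u v : Fin 3 → ℝ) : ℝ × ℝ →L[ℝ] ℝ × ℝ :=
  (Matrix.toLin (.finTwoProd ℝ) (.finTwoProd ℝ)
    !![u 1, u 2; v 1, v 2]).toContinuousLinearMap

lemma hasFDerivAt_affineMap (u v : Fin 3 → ℝ) (x : ℝ × ℝ) :
    HasFDerivAt (affineMap u v) (affineMapDeriv u v) x := by
  have h : affineMap u v = fun x => (u 0, v 0) + affineMapDeriv u v x := by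
    funext x
    rw [affineMapDeriv, Matrix.toLin_finTwoProd_toContinuousLinearMap]
    ext <;> simp [affineMap] <;> ring
  rw [h]
  exact (affineMapDeriv u v).hasFDerivAt.const_add _

lemma det_affineMapDeriv (u v : Fin 3 → ℝ) :
    (affineMapDeriv u v).det = u 1 * v 2 - u 2 * v 1 := by
  simp [affineMapDeriv, LinearMap.det_toContinuousLinearMap, LinearMap.det_toLin]

lemma affineMap_injective {u v : Fin 3 → ℝ} (h : u 1 * v 2 - u 2 * v 1 ≠ 0) :
    Function.Injective (affineMap u v) := by
  rintro ⟨a, b⟩ ⟨a', b'⟩ hab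
  simp only [affineMap, Prod.mk.injEq] at hab
  obtain ⟨h1, h2⟩ := hab
  refine Prod.ext (mul_left_cancel₀ h ?_) (mul_left_cancel₀ h ?_) <;> simp only
  · linear_combination v 2 * h1 - u 2 * h2
  · linear_combination u 1 * h2 - v 1 * h1

lemma affineMap_surjective {u v : Fin 3 → ℝ} (h : u 1 * v 2 - u 2 * v 1 ≠ 0) :
    Function.Surjective (affineMap u v) := by
  rintro ⟨a, b⟩
  refine ⟨((v 2 * (a - u 0) - u 2 * (b - v 0)) / (u 1 * v 2 - u 2 * v 1),
    (u 1 * (b - v 0) - v 1 * (a - u 0)) / (u 1 * v 2 - u 2 * v 1)), ?_⟩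
  simp only [affineMap, Prod.mk.injEq]
  generalize hd : u 1 * v 2 - u 2 * v 1 = d at h
  constructor <;> field_simp
  · linear_combination (a - u 0) * hd
  · linear_combination (b - v 0) * hd

lemma abs_det_mul_setIntegral {u v : Fin 3 → ℝ} (h : u 1 * v 2 - u 2 * v 1 ≠ 0)
    (f : ℝ × ℝ → ℝ) :
    |u 1 * v 2 - u 2 * v 1| * ∫ x in affineMap u v ⁻¹' unitSimplex, f (affineMap u v x)
      = ∫ p in unitSimplex, f p := by
  have hc : Continuous (affineMap u v) := by unfold affineMap; fun_prop
  conv_rhs => rw [← Set.image_preimage_eq unitSimplex (affineMap_surjective h)]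
  rw [integral_image_eq_integral_abs_det_fderiv_smul volume
    (isOpen_unitSimplex.preimage hc).measurableSet
    (fun x _ => (hasFDerivAt_affineMap u v x).hasFDerivWithinAt)
    (affineMap_injective h).injOn f]
  simp only [det_affineMapDeriv, smul_eq_mul, integral_const_mul]

lemma integrableOn_preimage_unitSimplex {u v : Fin 3 → ℝ} (h : u 1 * v 2 - u 2 * v 1 ≠ 0)
    {f : ℝ × ℝ → ℝ} (hf : Continuous f) :
    IntegrableOn (fun x => f (affineMap u v x)) (affineMap u v ⁻¹' unitSimplex) := by
  have hc : Continuous (affineMap u v) := by unfold affineMap; fun_prop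
  have := (integrableOn_image_iff_integrableOn_abs_det_fderiv_smul volume
    (isOpen_unitSimplex.preimage hc).measurableSet
    (fun x _ => (hasFDerivAt_affineMap u v x).hasFDerivWithinAt)
    (affineMap_injective h).injOn f).1
    (by rw [Set.image_preimage_eq unitSimplex (affineMap_surjective h)]
        exact integrableOn_unitSimplex hf)
  simp only [det_affineMapDeriv, smul_eq_mul] at this
  exact (integrable_const_mul_iff (abs_ne_zero.2 h).isUnit _).1 this

lemma volume_line_eq_zero {a b c : ℝ} (h : a ≠ 0 ∨ b ≠ 0) :
    volume {x : ℝ × ℝ | a * x.1 + b * x.2 = c} = 0 := by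
  let s : AffineSubspace ℝ (ℝ × ℝ) :=
    { carrier := {x | a * x.1 + b * x.2 = c}
      smul_vsub_vadd_mem' := by
        intro t p q r hp hq hr
        simp only [Set.mem_ofPred_eq, vsub_eq_sub, vadd_eq_add, Prod.fst_add, Prod.smul_fst,
          Prod.fst_sub, Prod.snd_add, Prod.smul_snd, Prod.snd_sub, smul_eq_mul] at *
        linear_combination t * hp - t * hq + hr }
  refine Measure.addHaar_affineSubspace volume s fun hs => ?_
  have hmem : ∀ x : ℝ × ℝ, a * x.1 + b * x.2 = c := fun x => by
    have : x ∈ s := hs ▸ AffineSubspace.mem_top ℝ _ x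
    exact this
  have h0 := hmem (0, 0)
  have h1 := hmem (1, 0)
  have h2 := hmem (0, 1)
  simp only [mul_zero, mul_one, zero_add, add_zero] at h0 h1 h2
  rcases h with h | h
  · exact h (by linarith)
  · exact h (by linarith)

/-! ### Barycentric coordinates and the geometry of the split -/

/-- The coefficients of the barycentric coordinates of the reference triangle. -/
noncomputable def baryCoeff (h₁ h₂ : ℝ) : Fin 3 → Fin 3 → ℝ :=
  ![![0, 0, h₂⁻¹], ![0, h₁⁻¹, 0], ![1, -h₁⁻¹, -h₂⁻¹]]

/-- The barycentric coordinates with respect to the vertices of the reference triangle. -/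
noncomputable def bary (h₁ h₂ : ℝ) (i : Fin 3) (x : ℝ × ℝ) : ℝ :=
  baryCoeff h₁ h₂ i 0 + baryCoeff h₁ h₂ i 1 * x.1 + baryCoeff h₁ h₂ i 2 * x.2

/-- The coefficients of the barycentric coordinate of the `i`-th cell that belongs to the
vertex `j ≠ i`. -/
noncomputable def cellCoeff (h₁ h₂ : ℝ) (z₀ : ℝ × ℝ) (i j k : Fin 3) : ℝ :=
  baryCoeff h₁ h₂ j k - bary h₁ h₂ j z₀ / bary h₁ h₂ i z₀ * baryCoeff h₁ h₂ i k

/-- The affine map sending the `i`-th cell to the unit simplex and `z₀` to the origin. -/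
noncomputable def cellMap (h₁ h₂ : ℝ) (z₀ : ℝ × ℝ) (i : Fin 3) : ℝ × ℝ → ℝ × ℝ :=
  affineMap (cellCoeff h₁ h₂ z₀ i (i + 1)) (cellCoeff h₁ h₂ z₀ i (i + 2))

/-- The `i`-th open cell of the split at `z₀`. -/
def openCell (h₁ h₂ : ℝ) (z₀ : ℝ × ℝ) (i : Fin 3) : Set (ℝ × ℝ) :=
  cellMap h₁ h₂ z₀ i ⁻¹' unitSimplex

lemma continuous_bary (i : Fin 3) : Continuous (bary h₁ h₂ i) := by unfold bary; fun_prop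

lemma continuous_cellMap (i : Fin 3) : Continuous (cellMap h₁ h₂ z₀ i) := by
  unfold cellMap affineMap; fun_prop

lemma isOpen_openCell (i : Fin 3) : IsOpen (openCell h₁ h₂ z₀ i) :=
  isOpen_unitSimplex.preimage (continuous_cellMap i)

lemma sum_bary (i : Fin 3) (x : ℝ × ℝ) :
    bary h₁ h₂ i x + bary h₁ h₂ (i + 1) x + bary h₁ h₂ (i + 2) x = 1 := by
  fin_cases i <;> simp [bary, baryCoeff] <;> ring

lemma cellMap_fst (i : Fin 3) (x : ℝ × ℝ) : (cellMap h₁ h₂ z₀ i x).1 =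
    bary h₁ h₂ (i + 1) x - bary h₁ h₂ (i + 1) z₀ * (bary h₁ h₂ i x / bary h₁ h₂ i z₀) := by
  simp only [cellMap, affineMap, cellCoeff]
  conv_rhs => rw [bary.eq_def h₁ h₂ _ x, bary.eq_def h₁ h₂ _ x]
  ring

lemma cellMap_snd (i : Fin 3) (x : ℝ × ℝ) : (cellMap h₁ h₂ z₀ i x).2 =
    bary h₁ h₂ (i + 2) x - bary h₁ h₂ (i + 2) z₀ * (bary h₁ h₂ i x / bary h₁ h₂ i z₀) := by
  simp only [cellMap, affineMap, cellCoeff]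
  conv_rhs => rw [bary.eq_def h₁ h₂ _ x, bary.eq_def h₁ h₂ _ x]
  ring

/-- The local coordinate of `z₀` vanishes on the outer edge of the cell, hence is a multiple of
`λ_i`. It is the restriction of the hat function to the cell. -/
lemma one_sub_cellMap (hz : ∀ i, 0 < bary h₁ h₂ i z₀) (i : Fin 3) (x : ℝ × ℝ) :
    1 - (cellMap h₁ h₂ z₀ i x).1 - (cellMap h₁ h₂ z₀ i x).2 =
      bary h₁ h₂ i x / bary h₁ h₂ i z₀ := by
  have h := (hz i).ne'
  rw [cellMap_fst, cellMap_snd]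
  have hx := sum_bary (h₁ := h₁) (h₂ := h₂) i x
  have h0 := sum_bary (h₁ := h₁) (h₂ := h₂) i z₀
  field_simp
  linear_combination (bary h₁ h₂ i x) * h0 - (bary h₁ h₂ i z₀) * hx

lemma bary_refVertices (hh₁ : h₁ ≠ 0) (hh₂ : h₂ ≠ 0) (i j : Fin 3) :
    bary h₁ h₂ i (refVertices h₁ h₂ j) = if i = j then 1 else 0 := by
  fin_cases i <;> fin_cases j <;> simp [bary, baryCoeff, refVertices, hh₁, hh₂]

lemma bary_combination (hh₁ : h₁ ≠ 0) (hh₂ : h₂ ≠ 0) (i : Fin 3) (x : ℝ × ℝ) :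
    bary h₁ h₂ i x • refVertices h₁ h₂ i + bary h₁ h₂ (i + 1) x • refVertices h₁ h₂ (i + 1)
      + bary h₁ h₂ (i + 2) x • refVertices h₁ h₂ (i + 2) = x := by
  fin_cases i <;> ext <;> simp [bary, baryCoeff, refVertices] <;> field_simp

lemma cellMap_combination (hh₁ : h₁ ≠ 0) (hh₂ : h₂ ≠ 0) (hz : ∀ i, 0 < bary h₁ h₂ i z₀)
    (i : Fin 3) (x : ℝ × ℝ) :
    (1 - (cellMap h₁ h₂ z₀ i x).1 - (cellMap h₁ h₂ z₀ i x).2) • z₀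
      + (cellMap h₁ h₂ z₀ i x).1 • refVertices h₁ h₂ (i + 1)
      + (cellMap h₁ h₂ z₀ i x).2 • refVertices h₁ h₂ (i + 2) = x := by
  have h := (hz i).ne'
  rw [one_sub_cellMap hz, cellMap_fst, cellMap_snd]
  have e : ∀ m : ℝ, m • z₀ = (m * bary h₁ h₂ i z₀) • refVertices h₁ h₂ i
      + (m * bary h₁ h₂ (i + 1) z₀) • refVertices h₁ h₂ (i + 1)
      + (m * bary h₁ h₂ (i + 2) z₀) • refVertices h₁ h₂ (i + 2) := fun m => by
    conv_lhs => rw [← bary_combination hh₁ hh₂ i z₀]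
    module
  rw [e, div_mul_cancel₀ _ h]
  conv_rhs => rw [← bary_combination hh₁ hh₂ i x]
  generalize bary h₁ h₂ i x / bary h₁ h₂ i z₀ = m
  module

/-- The three cyclic minors of the gradients `∇λ` all equal `-(h₁ h₂)⁻¹`, and they enter with
weights that sum to one. The sign is negative because the vertices are numbered clockwise. -/
lemma det_cellCoeff (hz : ∀ i, 0 < bary h₁ h₂ i z₀) (i : Fin 3) :
    cellCoeff h₁ h₂ z₀ i (i + 1) 1 * cellCoeff h₁ h₂ z₀ i (i + 2) 2
      - cellCoeff h₁ h₂ z₀ i (i + 1) 2 * cellCoeff h₁ h₂ z₀ i (i + 2) 1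
      = -(bary h₁ h₂ i z₀ * (h₁ * h₂))⁻¹ := by
  have h0 := sum_bary (h₁ := h₁) (h₂ := h₂) i z₀
  have h := (hz i).ne'
  have key : baryCoeff h₁ h₂ (i + 1) 1 * baryCoeff h₁ h₂ (i + 2) 2
      - baryCoeff h₁ h₂ (i + 1) 2 * baryCoeff h₁ h₂ (i + 2) 1 = -(h₁ * h₂)⁻¹ ∧
      baryCoeff h₁ h₂ (i + 2) 1 * baryCoeff h₁ h₂ i 2
      - baryCoeff h₁ h₂ (i + 2) 2 * baryCoeff h₁ h₂ i 1 = -(h₁ * h₂)⁻¹ ∧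
      baryCoeff h₁ h₂ i 1 * baryCoeff h₁ h₂ (i + 1) 2
      - baryCoeff h₁ h₂ i 2 * baryCoeff h₁ h₂ (i + 1) 1 = -(h₁ * h₂)⁻¹ := by
    fin_cases i <;> simp [baryCoeff, mul_comm]
  obtain ⟨k1, k2, k3⟩ := key
  simp only [cellCoeff]
  rw [mul_inv]
  generalize (h₁ * h₂)⁻¹ = d at *
  field_simp
  linear_combination (bary h₁ h₂ i z₀) * ((bary h₁ h₂ i z₀) * k1 + (bary h₁ h₂ (i + 1) z₀) * k2
    + (bary h₁ h₂ (i + 2) z₀) * k3 - d * h0)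

lemma triangle_refVertices (hh₁ : h₁ ≠ 0) (hh₂ : h₂ ≠ 0) :
    triangle (refVertices h₁ h₂) = {x | ∀ i, 0 ≤ bary h₁ h₂ i x} := by
  apply subset_antisymm
  · refine convexHull_min ?_ ?_
    · rintro _ ⟨j, rfl⟩ i
      rw [bary_refVertices hh₁ hh₂]
      split_ifs <;> simp
    · intro x hx y hy a b ha hb hab i
      have : bary h₁ h₂ i (a • x + b • y) = a * bary h₁ h₂ i x + b * bary h₁ h₂ i y := by
        simp only [bary, Prod.fst_add, Prod.smul_fst, Prod.snd_add, Prod.smul_snd, smul_eq_mul]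
        linear_combination (-baryCoeff h₁ h₂ i 0) * hab
      rw [this]
      exact add_nonneg (mul_nonneg ha (hx i)) (mul_nonneg hb (hy i))
  · intro x hx
    have hs : ∑ i, bary h₁ h₂ i x = 1 := by
      rw [Fin.sum_univ_three]; exact sum_bary 0 x
    have := (convex_convexHull ℝ (Set.range (refVertices h₁ h₂))).sum_mem
      (fun i _ => hx i) hs (fun i _ => subset_convexHull ℝ _ (Set.mem_range_self i))
    rw [Fin.sum_univ_three] at this
    have hc := bary_combination hh₁ hh₂ 0 x
    simp only [zero_add] at hc
    rwa [hc] at this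

lemma isOpen_bary_pos : IsOpen {x | ∀ i, 0 < bary h₁ h₂ i x} := by
  rw [Set.ofPred_forall]
  exact isOpen_iInter_of_finite fun i => isOpen_lt continuous_const (continuous_bary i)

lemma refDomain_eq (hh₁ : 0 < h₁) (hh₂ : 0 < h₂) :
    refDomain h₁ h₂ = {x | ∀ i, 0 < bary h₁ h₂ i x} := by
  apply subset_antisymm
  · intro x hx i
    have hle : ∀ y ∈ refDomain h₁ h₂, 0 ≤ bary h₁ h₂ i y := fun y hy => by
      have := interior_subset hy
      rw [triangle_refVertices hh₁.ne' hh₂.ne'] at this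
      exact this i
    -- A small step from `x` directly away from vertex `i` stays in the interior and changes
    -- `λ_i(x)` to `(1 + t) λ_i(x) - t`, which would be negative if `λ_i(x) ≤ 0`.
    have hev : ∀ᶠ t : ℝ in nhdsWithin 0 (Set.Ioi 0),
        x - t • (refVertices h₁ h₂ i - x) ∈ refDomain h₁ h₂ := by
      have hc : Continuous fun t : ℝ => x - t • (refVertices h₁ h₂ i - x) := by fun_prop
      have := hc.tendsto 0
      simp only [zero_smul, sub_zero] at this
      exact (this.mono_left nhdsWithin_le_nhds) (isOpen_interior.mem_nhds hx)
    obtain ⟨t, ht, ht0⟩ := (hev.and self_mem_nhdsWithin).exists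
    have h1 := hle _ ht
    have h2 : bary h₁ h₂ i (x - t • (refVertices h₁ h₂ i - x)) =
        (1 + t) * bary h₁ h₂ i x - t * bary h₁ h₂ i (refVertices h₁ h₂ i) := by
      simp only [bary, Prod.fst_sub, Prod.smul_fst, Prod.snd_sub, Prod.smul_snd, smul_eq_mul]
      ring
    rw [h2, bary_refVertices hh₁.ne' hh₂.ne', if_pos rfl] at h1
    have ht0' : 0 < t := ht0
    by_contra hneg
    nlinarith
  · refine interior_maximal ?_ isOpen_bary_pos
    rw [triangle_refVertices hh₁.ne' hh₂.ne']
    exact fun x hx i => (hx i).le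

lemma mem_frontier_triangle (hh₁ : 0 < h₁) (hh₂ : 0 < h₂) {x : ℝ × ℝ}
    (hx : x ∈ triangle (refVertices h₁ h₂)) {i : Fin 3} (hi : bary h₁ h₂ i x = 0) :
    x ∈ frontier (triangle (refVertices h₁ h₂)) := by
  refine ⟨subset_closure hx, fun h => ?_⟩
  have h' : x ∈ refDomain h₁ h₂ := h
  rw [refDomain_eq hh₁ hh₂] at h'
  exact (h' i).ne' hi

/-- Cleared of denominators: the cell is the part of the triangle where the ratio `λ_j(x) / λ_j(z₀)`
is strictly smallest at `j = i`. Disjointness and covering of the cells are read off from this form.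
-/
lemma mem_openCell (hz : ∀ i, 0 < bary h₁ h₂ i z₀) (i : Fin 3) (x : ℝ × ℝ) :
    x ∈ openCell h₁ h₂ z₀ i ↔
      bary h₁ h₂ (i + 1) z₀ * bary h₁ h₂ i x < bary h₁ h₂ i z₀ * bary h₁ h₂ (i + 1) x ∧
      bary h₁ h₂ (i + 2) z₀ * bary h₁ h₂ i x < bary h₁ h₂ i z₀ * bary h₁ h₂ (i + 2) x ∧
      0 < bary h₁ h₂ i x := by
  simp only [openCell, Set.mem_preimage, unitSimplex, Set.mem_ofPred_eq]
  rw [one_sub_cellMap hz, cellMap_fst, cellMap_snd, sub_pos, sub_pos, div_pos_iff_of_pos_right (hz i),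
    ← mul_div_assoc, ← mul_div_assoc, div_lt_iff₀' (hz i), div_lt_iff₀' (hz i)]

lemma openCell_subset_cell (hh₁ : h₁ ≠ 0) (hh₂ : h₂ ≠ 0) (hz : ∀ i, 0 < bary h₁ h₂ i z₀)
    (i : Fin 3) : openCell h₁ h₂ z₀ i ⊆ cell (refVertices h₁ h₂) z₀ i := by
  rintro x ⟨h1, h2, h3⟩
  have hj : ∀ j ≠ i, refVertices h₁ h₂ j ∈ cell (refVertices h₁ h₂) z₀ i := fun j hj =>
    subset_convexHull ℝ _ (Or.inr ⟨j, hj, rfl⟩)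
  have h0 : z₀ ∈ cell (refVertices h₁ h₂) z₀ i := subset_convexHull ℝ _ (Or.inl rfl)
  have hc : Convex ℝ (cell (refVertices h₁ h₂) z₀ i) := convex_convexHull ℝ _
  have := hc.sum_mem (t := (Finset.univ : Finset (Fin 3)))
    (w := ![1 - (cellMap h₁ h₂ z₀ i x).1 - (cellMap h₁ h₂ z₀ i x).2,
      (cellMap h₁ h₂ z₀ i x).1, (cellMap h₁ h₂ z₀ i x).2])
    (z := ![z₀, refVertices h₁ h₂ (i + 1), refVertices h₁ h₂ (i + 2)])
    (by simp [Fin.forall_fin_succ, -sub_nonneg, h1.le, h2.le, h3.le])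
    (by simp only [Fin.sum_univ_three, Matrix.cons_val]; ring)
    (by simp [Fin.forall_fin_succ, h0, hj])
  simp only [Fin.sum_univ_three, Matrix.cons_val] at this
  rwa [cellMap_combination hh₁ hh₂ hz] at this

lemma pairwise_disjoint_openCell (hz : ∀ i, 0 < bary h₁ h₂ i z₀) :
    Pairwise (Function.onFun Disjoint (openCell h₁ h₂ z₀)) := by
  intro i j hij
  refine Set.disjoint_left.2 fun x hi hj => ?_
  rw [mem_openCell hz] at hi hj
  fin_cases i <;> fin_cases j <;> first | exact absurd rfl hij | skip
  all_goals
    simp at hi hj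
    linarith [hi.1, hi.2.1, hj.1, hj.2.1]

lemma openCell_subset_refDomain (hh₁ : 0 < h₁) (hh₂ : 0 < h₂) (hz : ∀ i, 0 < bary h₁ h₂ i z₀)
    (i : Fin 3) : openCell h₁ h₂ z₀ i ⊆ refDomain h₁ h₂ := by
  intro x hx
  rw [mem_openCell hz] at hx
  rw [refDomain_eq hh₁ hh₂]
  obtain ⟨h1, h2, h3⟩ := hx
  have h1' := pos_of_mul_pos_right ((mul_pos (hz (i + 1)) h3).trans h1) (hz i).le
  have h2' := pos_of_mul_pos_right ((mul_pos (hz (i + 2)) h3).trans h2) (hz i).le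
  intro k
  fin_cases i <;> fin_cases k <;> assumption

/-- Some ratio `λ_i(x) / λ_i(z₀)` is minimal, and ties occur only on three lines, which are null
sets. -/
lemma refDomain_ae_eq (hh₁ : 0 < h₁) (hh₂ : 0 < h₂) (hz : ∀ i, 0 < bary h₁ h₂ i z₀) :
    (⋃ i, openCell h₁ h₂ z₀ i : Set (ℝ × ℝ)) =ᵐ[volume] refDomain h₁ h₂ := by
  have line : ∀ i j : Fin 3, i ≠ j → ∀ᵐ x : ℝ × ℝ,
      bary h₁ h₂ i z₀ * bary h₁ h₂ j x ≠ bary h₁ h₂ j z₀ * bary h₁ h₂ i x := by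
    intro i j hij
    have hne : bary h₁ h₂ i z₀ * baryCoeff h₁ h₂ j 1 - bary h₁ h₂ j z₀ * baryCoeff h₁ h₂ i 1 ≠ 0 ∨
        bary h₁ h₂ i z₀ * baryCoeff h₁ h₂ j 2 - bary h₁ h₂ j z₀ * baryCoeff h₁ h₂ i 2 ≠ 0 := by
      have a := (hz i).ne'
      have b := (hz j).ne'
      fin_cases i <;> fin_cases j <;> first | exact absurd rfl hij | skip
      all_goals simp [baryCoeff] at a b ⊢
      all_goals simp [a, b, hh₁.ne', hh₂.ne']
    rw [ae_iff]
    refine measure_mono_null (fun x hx => ?_) (volume_line_eq_zero (c := bary h₁ h₂ j z₀ *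
      baryCoeff h₁ h₂ i 0 - bary h₁ h₂ i z₀ * baryCoeff h₁ h₂ j 0) hne)
    have h := not_not.1 hx
    rw [bary.eq_def h₁ h₂ _ x, bary.eq_def h₁ h₂ _ x] at h
    simp only [Set.mem_ofPred_eq]
    linear_combination h
  refine (Set.iUnion_subset fun i =>
    openCell_subset_refDomain hh₁ hh₂ hz i).eventuallyLE.antisymm ?_
  have hall : ∀ᵐ x : ℝ × ℝ, ∀ i j : Fin 3, i ≠ j →
      bary h₁ h₂ i z₀ * bary h₁ h₂ j x ≠ bary h₁ h₂ j z₀ * bary h₁ h₂ i x :=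
    ae_all_iff.2 fun i => ae_all_iff.2 fun j => Filter.eventually_imp_distrib_left.2 (line i j)
  filter_upwards [hall] with x hxl hx
  have hx' : x ∈ refDomain h₁ h₂ := hx
  rw [refDomain_eq hh₁ hh₂] at hx'
  obtain ⟨i, hi⟩ := Finite.exists_min fun i => bary h₁ h₂ i x / bary h₁ h₂ i z₀
  have hlt : ∀ j, i ≠ j → bary h₁ h₂ j z₀ * bary h₁ h₂ i x < bary h₁ h₂ i z₀ * bary h₁ h₂ j x := by
    intro j hij
    refine lt_of_le_of_ne ?_ (hxl i j hij).symm
    have := (div_le_div_iff₀ (hz i) (hz j)).1 (hi j)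
    linarith
  have hne : ∀ i : Fin 3, i ≠ i + 1 ∧ i ≠ i + 2 := by decide
  exact Set.mem_iUnion.2 ⟨i, (mem_openCell hz i x).2 ⟨hlt _ (hne i).1, hlt _ (hne i).2, hx' i⟩⟩

/-! ### Square integrals of piecewise affine functions -/

/-- On each open cell, `F` is the affine function whose values at `z₀` and at the two other
vertices of the cell are given by `V`. -/
def HasVertexValues (h₁ h₂ : ℝ) (z₀ : ℝ × ℝ) (F : ℝ × ℝ → ℝ) (V : Fin 3 → Fin 3 → ℝ) : Prop :=
  ∀ i, ∀ x ∈ openCell h₁ h₂ z₀ i, F x =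
    V i 0 * (1 - (cellMap h₁ h₂ z₀ i x).1 - (cellMap h₁ h₂ z₀ i x).2)
      + V i 1 * (cellMap h₁ h₂ z₀ i x).1 + V i 2 * (cellMap h₁ h₂ z₀ i x).2

lemma HasVertexValues.integrableOn_cell (hh₁ : 0 < h₁) (hh₂ : 0 < h₂)
    (hz : ∀ i, 0 < bary h₁ h₂ i z₀) {F : ℝ × ℝ → ℝ} {V : Fin 3 → Fin 3 → ℝ}
    (hF : HasVertexValues h₁ h₂ z₀ F V) (i : Fin 3) :
    IntegrableOn (fun x => F x ^ 2) (openCell h₁ h₂ z₀ i) := by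
  have hd : cellCoeff h₁ h₂ z₀ i (i + 1) 1 * cellCoeff h₁ h₂ z₀ i (i + 2) 2
      - cellCoeff h₁ h₂ z₀ i (i + 1) 2 * cellCoeff h₁ h₂ z₀ i (i + 2) 1 ≠ 0 := by
    rw [det_cellCoeff hz]
    exact neg_ne_zero.2 (inv_ne_zero (mul_pos (hz i) (mul_pos hh₁ hh₂)).ne')
  refine (integrableOn_preimage_unitSimplex hd (f := fun p =>
    (V i 0 * (1 - p.1 - p.2) + V i 1 * p.1 + V i 2 * p.2) ^ 2) (by fun_prop)).congr_fun
    (fun x hx => ?_) (isOpen_openCell i).measurableSet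
  simp only [hF i x hx, cellMap]

lemma HasVertexValues.integral_cell (hh₁ : 0 < h₁) (hh₂ : 0 < h₂)
    (hz : ∀ i, 0 < bary h₁ h₂ i z₀) {F : ℝ × ℝ → ℝ} {V : Fin 3 → Fin 3 → ℝ}
    (hF : HasVertexValues h₁ h₂ z₀ F V) (i : Fin 3) :
    ∫ x in openCell h₁ h₂ z₀ i, F x ^ 2 =
      bary h₁ h₂ i z₀ * (h₁ * h₂) * (massForm (V i 0) (V i 1) (V i 2) / 12) := by
  have hp := mul_pos (hz i) (mul_pos hh₁ hh₂)
  have hd : cellCoeff h₁ h₂ z₀ i (i + 1) 1 * cellCoeff h₁ h₂ z₀ i (i + 2) 2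
      - cellCoeff h₁ h₂ z₀ i (i + 1) 2 * cellCoeff h₁ h₂ z₀ i (i + 2) 1 ≠ 0 := by
    rw [det_cellCoeff hz]
    exact neg_ne_zero.2 (inv_ne_zero hp.ne')
  have key := abs_det_mul_setIntegral hd (fun p =>
    (V i 0 * (1 - p.1 - p.2) + V i 1 * p.1 + V i 2 * p.2) ^ 2)
  rw [integral_sq_unitSimplex, det_cellCoeff hz, abs_neg, abs_of_pos (inv_pos.2 hp)] at key
  rw [← key, mul_inv_cancel_left₀ hp.ne']
  refine setIntegral_congr_fun (isOpen_openCell i).measurableSet fun x hx => ?_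
  simp only [hF i x hx, cellMap]

lemma HasVertexValues.integrableOn (hh₁ : 0 < h₁) (hh₂ : 0 < h₂)
    (hz : ∀ i, 0 < bary h₁ h₂ i z₀) {F : ℝ × ℝ → ℝ} {V : Fin 3 → Fin 3 → ℝ}
    (hF : HasVertexValues h₁ h₂ z₀ F V) :
    IntegrableOn (fun x => F x ^ 2) (refDomain h₁ h₂) := by
  rw [← integrableOn_congr_set_ae (refDomain_ae_eq hh₁ hh₂ hz)]
  exact integrableOn_finite_iUnion.2 (hF.integrableOn_cell hh₁ hh₂ hz)

lemma HasVertexValues.integral_sq (hh₁ : 0 < h₁) (hh₂ : 0 < h₂)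
    (hz : ∀ i, 0 < bary h₁ h₂ i z₀) {F : ℝ × ℝ → ℝ} {V : Fin 3 → Fin 3 → ℝ}
    (hF : HasVertexValues h₁ h₂ z₀ F V) :
    ∫ x in refDomain h₁ h₂, F x ^ 2 = h₁ * h₂ / 12 *
      ∑ i, bary h₁ h₂ i z₀ * massForm (V i 0) (V i 1) (V i 2) := by
  rw [← setIntegral_congr_set (refDomain_ae_eq hh₁ hh₂ hz),
    integral_iUnion_fintype (fun i => (isOpen_openCell i).measurableSet)
    (pairwise_disjoint_openCell hz) (hF.integrableOn_cell hh₁ hh₂ hz), Finset.mul_sum]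
  refine Finset.sum_congr rfl fun i _ => ?_
  rw [hF.integral_cell hh₁ hh₂ hz]
  ring

/-! ### Piecewise quadratics as the hat function times affine functions -/

lemma add_le_of_mem_support {p : MvPolynomial (Fin 2) ℝ} {k : ℕ} (hp : p.totalDegree ≤ k)
    {d : Fin 2 →₀ ℕ} (hd : d ∈ p.support) : d 0 + d 1 ≤ k := by
  have := (MvPolynomial.le_totalDegree hd).trans hp
  rwa [Finsupp.sum_fintype _ _ (fun _ => rfl), Fin.sum_univ_two] at this

/-- Lagrange interpolation at the vertices and edge midpoints. The identity is linear in `p`, so it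
is checked on the monomials of degree at most two. -/
lemma eval_quadratic_interpolation {p : MvPolynomial (Fin 2) ℝ} (hp : p.totalDegree ≤ 2)
    (P Q R : ℝ × ℝ) (s t : ℝ) :
    MvPolynomial.eval ![((1 - s - t) • P + s • Q + t • R).1, ((1 - s - t) • P + s • Q + t • R).2] p
      = (1 - s - t) * (2 * (1 - s - t) - 1) * MvPolynomial.eval ![P.1, P.2] p
        + s * (2 * s - 1) * MvPolynomial.eval ![Q.1, Q.2] p
        + t * (2 * t - 1) * MvPolynomial.eval ![R.1, R.2] p
        + 4 * (1 - s - t) * s * MvPolynomial.eval ![(midpoint ℝ P Q).1, (midpoint ℝ P Q).2] p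
        + 4 * s * t * MvPolynomial.eval ![(midpoint ℝ Q R).1, (midpoint ℝ Q R).2] p
        + 4 * t * (1 - s - t)
          * MvPolynomial.eval ![(midpoint ℝ P R).1, (midpoint ℝ P R).2] p := by
  simp only [MvPolynomial.eval_eq', Finset.mul_sum, ← Finset.sum_add_distrib]
  refine Finset.sum_congr rfl fun d hd => ?_
  have hd := add_le_of_mem_support hp hd
  obtain ⟨P1, P2⟩ := P
  obtain ⟨Q1, Q2⟩ := Q
  obtain ⟨R1, R2⟩ := R
  simp only [Fin.prod_univ_two, midpoint_eq_smul_add, Matrix.cons_val, Prod.smul_mk,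
    Prod.mk_add_mk, smul_eq_mul]
  generalize d 0 = m at *
  generalize d 1 = n at *
  have hm : m ≤ 2 := by omega
  have hn : n ≤ 2 := by omega
  interval_cases m <;> interval_cases n <;> first | omega | (simp only [invOf_eq_inv]; ring)

lemma eval_midpoint_of_affine {p : MvPolynomial (Fin 2) ℝ} (hp : p.totalDegree ≤ 1)
    (P Q : ℝ × ℝ) :
    MvPolynomial.eval ![(midpoint ℝ P Q).1, (midpoint ℝ P Q).2] p
      = (MvPolynomial.eval ![P.1, P.2] p + MvPolynomial.eval ![Q.1, Q.2] p) / 2 := by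
  simp only [MvPolynomial.eval_eq', ← Finset.sum_add_distrib, Finset.sum_div]
  refine Finset.sum_congr rfl fun d hd => ?_
  have hd := add_le_of_mem_support hp hd
  obtain ⟨P1, P2⟩ := P
  obtain ⟨Q1, Q2⟩ := Q
  simp only [Fin.prod_univ_two, midpoint_eq_smul_add, Matrix.cons_val, Prod.smul_mk,
    Prod.mk_add_mk, smul_eq_mul]
  generalize d 0 = m at *
  generalize d 1 = n at *
  have hm : m ≤ 1 := by omega
  have hn : n ≤ 1 := by omega
  interval_cases m <;> interval_cases n <;> first | omega | (simp only [invOf_eq_inv]; ring)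

/-- The coefficients of a continuous piecewise quadratic function on the split: on each cell it is
the hat function times the affine function with value `f z₀` at `z₀` and `edgeCoeff f j` at the
vertex `j`. -/
noncomputable def edgeCoeff (h₁ h₂ : ℝ) (z₀ : ℝ × ℝ) (f : ℝ × ℝ → ℝ) (j : Fin 3) : ℝ :=
  4 * f (midpoint ℝ z₀ (refVertices h₁ h₂ j)) - f z₀

lemma refVertices_mem_frontier (hh₁ : 0 < h₁) (hh₂ : 0 < h₂) (j : Fin 3) :
    refVertices h₁ h₂ j ∈ frontier (triangle (refVertices h₁ h₂)) := by
  refine mem_frontier_triangle hh₁ hh₂ (subset_convexHull ℝ _ (Set.mem_range_self j))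
    (i := j + 1) ?_
  rw [bary_refVertices hh₁.ne' hh₂.ne', if_neg (by revert j; decide)]

lemma midpoint_refVertices_mem_frontier (hh₁ : 0 < h₁) (hh₂ : 0 < h₂) (i : Fin 3) :
    midpoint ℝ (refVertices h₁ h₂ (i + 1)) (refVertices h₁ h₂ (i + 2))
      ∈ frontier (triangle (refVertices h₁ h₂)) := by
  refine mem_frontier_triangle hh₁ hh₂ ((convex_convexHull ℝ _).midpoint_mem
    (subset_convexHull ℝ _ (Set.mem_range_self _))
    (subset_convexHull ℝ _ (Set.mem_range_self _))) (i := i) ?_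
  fin_cases i <;> simp [bary, baryCoeff, refVertices, midpoint_eq_smul_add]
  field_simp
  norm_num

/-- Three of the six Lagrange nodes lie on the boundary of the triangle and drop out. With `m = 1 -
s - t`, the basis functions of the others are divisible by `m`, and `2 * m - 1 = m - s - t` produces
the coefficients `edgeCoeff`. -/
lemma eq_on_openCell (hh₁ : 0 < h₁) (hh₂ : 0 < h₂) (hz : ∀ i, 0 < bary h₁ h₂ i z₀)
    {f : ℝ × ℝ → ℝ} (hf : f ∈ scalarSpace 2 (refVertices h₁ h₂) z₀) (i : Fin 3) {x : ℝ × ℝ}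
    (hx : x ∈ openCell h₁ h₂ z₀ i) :
    f x = (1 - (cellMap h₁ h₂ z₀ i x).1 - (cellMap h₁ h₂ z₀ i x).2) *
      (f z₀ * (1 - (cellMap h₁ h₂ z₀ i x).1 - (cellMap h₁ h₂ z₀ i x).2)
        + edgeCoeff h₁ h₂ z₀ f (i + 1) * (cellMap h₁ h₂ z₀ i x).1
        + edgeCoeff h₁ h₂ z₀ f (i + 2) * (cellMap h₁ h₂ z₀ i x).2) := by
  obtain ⟨-, hbd, hpoly⟩ := hf
  obtain ⟨p, hp, hfp⟩ := hpoly i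
  have hc : Convex ℝ (cell (refVertices h₁ h₂) z₀ i) := convex_convexHull ℝ _
  have m0 : z₀ ∈ cell (refVertices h₁ h₂) z₀ i := subset_convexHull ℝ _ (Or.inl rfl)
  have m1 : refVertices h₁ h₂ (i + 1) ∈ cell (refVertices h₁ h₂) z₀ i :=
    subset_convexHull ℝ _ (Or.inr ⟨i + 1, by simp, rfl⟩)
  have m2 : refVertices h₁ h₂ (i + 2) ∈ cell (refVertices h₁ h₂) z₀ i :=
    subset_convexHull ℝ _ (Or.inr ⟨i + 2, by simp, rfl⟩)
  have key := eval_quadratic_interpolation hp z₀ (refVertices h₁ h₂ (i + 1))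
    (refVertices h₁ h₂ (i + 2)) (cellMap h₁ h₂ z₀ i x).1 (cellMap h₁ h₂ z₀ i x).2
  rw [cellMap_combination hh₁.ne' hh₂.ne' hz, ← hfp x (openCell_subset_cell hh₁.ne' hh₂.ne' hz i hx),
    ← hfp _ m0, ← hfp _ m1, ← hfp _ m2, ← hfp _ (hc.midpoint_mem m0 m1),
    ← hfp _ (hc.midpoint_mem m0 m2), ← hfp _ (hc.midpoint_mem m1 m2),
    hbd _ (refVertices_mem_frontier hh₁ hh₂ _), hbd _ (refVertices_mem_frontier hh₁ hh₂ _),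
    hbd _ (midpoint_refVertices_mem_frontier hh₁ hh₂ i)] at key
  rw [key, edgeCoeff, edgeCoeff]
  ring

lemma scalarSpace_mono {k l : ℕ} (hkl : k ≤ l) {z : Fin 3 → ℝ × ℝ} :
    scalarSpace k z z₀ ⊆ scalarSpace l z z₀ :=
  fun _ hf => ⟨hf.1, hf.2.1, fun i => (hf.2.2 i).imp fun _ hp => ⟨hp.1.trans hkl, hp.2⟩⟩

lemma edgeCoeff_hat (hh₁ : 0 < h₁) (hh₂ : 0 < h₂) {μ : ℝ × ℝ → ℝ}
    (hμ : IsHatFunction (refVertices h₁ h₂) z₀ μ) (j : Fin 3) :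
    edgeCoeff h₁ h₂ z₀ μ j = 1 := by
  obtain ⟨⟨-, hbd, hpoly⟩, h1⟩ := hμ
  obtain ⟨p, hp, hfp⟩ := hpoly (j + 1)
  have hc : Convex ℝ (cell (refVertices h₁ h₂) z₀ (j + 1)) := convex_convexHull ℝ _
  have m0 : z₀ ∈ cell (refVertices h₁ h₂) z₀ (j + 1) := subset_convexHull ℝ _ (Or.inl rfl)
  have m1 : refVertices h₁ h₂ j ∈ cell (refVertices h₁ h₂) z₀ (j + 1) :=
    subset_convexHull ℝ _ (Or.inr ⟨j, by simp, rfl⟩)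
  have key := eval_midpoint_of_affine hp z₀ (refVertices h₁ h₂ j)
  rw [← hfp _ m0, ← hfp _ m1, ← hfp _ (hc.midpoint_mem m0 m1),
    hbd _ (refVertices_mem_frontier hh₁ hh₂ _), h1] at key
  rw [edgeCoeff, key, h1]
  norm_num

/-! ### Derivatives on the cells -/

/-- The vertex values on the cells of the derivative in direction `x_k` of the function with value
`A` at `z₀` and edge coefficients `B`. -/
noncomputable def derivValues (h₁ h₂ : ℝ) (z₀ : ℝ × ℝ) (k : Fin 3) (A : ℝ) (B : Fin 3 → ℝ)
    (i : Fin 3) : Fin 3 → ℝ :=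
  ![2 * A * (baryCoeff h₁ h₂ i k / bary h₁ h₂ i z₀)
      + B (i + 1) * cellCoeff h₁ h₂ z₀ i (i + 1) k + B (i + 2) * cellCoeff h₁ h₂ z₀ i (i + 2) k,
    B (i + 1) * (baryCoeff h₁ h₂ i k / bary h₁ h₂ i z₀),
    B (i + 2) * (baryCoeff h₁ h₂ i k / bary h₁ h₂ i z₀)]

/-- Both sides are the `k`-th derivative of the hat function on the cell; `k = 0` is the index of
the constant term. -/
lemma neg_sum_cellCoeff (hz : ∀ i, 0 < bary h₁ h₂ i z₀) (i k : Fin 3) (hk : k ≠ 0) :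
    -cellCoeff h₁ h₂ z₀ i (i + 1) k - cellCoeff h₁ h₂ z₀ i (i + 2) k
      = baryCoeff h₁ h₂ i k / bary h₁ h₂ i z₀ := by
  have h := (hz i).ne'
  have h0 := sum_bary (h₁ := h₁) (h₂ := h₂) i z₀
  have hs : baryCoeff h₁ h₂ i k + baryCoeff h₁ h₂ (i + 1) k + baryCoeff h₁ h₂ (i + 2) k = 0 := by
    fin_cases k
    · exact absurd rfl hk
    all_goals fin_cases i <;> simp [baryCoeff]
  simp only [cellCoeff]
  field_simp
  linear_combination (baryCoeff h₁ h₂ i k) * h0 - (bary h₁ h₂ i z₀) * hs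

/-- The product rule for `μ` times an affine function. The factor `μ` is one at `z₀` and zero at the
other two vertices of the cell, which gives the entries of `derivValues`. -/
lemma fderiv_on_openCell (hh₁ : 0 < h₁) (hh₂ : 0 < h₂) (hz : ∀ i, 0 < bary h₁ h₂ i z₀)
    {f : ℝ × ℝ → ℝ} (hf : f ∈ scalarSpace 2 (refVertices h₁ h₂) z₀) (i : Fin 3) {x : ℝ × ℝ}
    (hx : x ∈ openCell h₁ h₂ z₀ i) :
    ∀ a b : ℝ, fderiv ℝ f x (a, b) =
      (a * (derivValues h₁ h₂ z₀ 1 (f z₀) (edgeCoeff h₁ h₂ z₀ f) i 0)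
        + b * (derivValues h₁ h₂ z₀ 2 (f z₀) (edgeCoeff h₁ h₂ z₀ f) i 0))
        * (1 - (cellMap h₁ h₂ z₀ i x).1 - (cellMap h₁ h₂ z₀ i x).2)
      + (a * (derivValues h₁ h₂ z₀ 1 (f z₀) (edgeCoeff h₁ h₂ z₀ f) i 1)
        + b * (derivValues h₁ h₂ z₀ 2 (f z₀) (edgeCoeff h₁ h₂ z₀ f) i 1))
        * (cellMap h₁ h₂ z₀ i x).1
      + (a * (derivValues h₁ h₂ z₀ 1 (f z₀) (edgeCoeff h₁ h₂ z₀ f) i 2)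
        + b * (derivValues h₁ h₂ z₀ 2 (f z₀) (edgeCoeff h₁ h₂ z₀ f) i 2))
        * (cellMap h₁ h₂ z₀ i x).2 := by
  set A := f z₀
  set B := edgeCoeff h₁ h₂ z₀ f
  have hψ := hasFDerivAt_affineMap (cellCoeff h₁ h₂ z₀ i (i + 1)) (cellCoeff h₁ h₂ z₀ i (i + 2)) x
  have hs := hψ.fst
  have ht := hψ.snd
  have hm := (hs.const_sub 1).sub ht
  have hg := hm.mul (((hm.const_mul A).add (hs.const_mul (B (i + 1)))).add
    (ht.const_mul (B (i + 2))))
  have heq : f =ᶠ[nhds x] _ := Filter.eventuallyEq_of_mem ((isOpen_openCell i).mem_nhds hx)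
    fun y hy => eq_on_openCell hh₁ hh₂ hz hf i hy
  intro a b
  rw [(hg.congr_of_eventuallyEq heq).fderiv]
  have e1 := neg_sum_cellCoeff hz i 1 (by decide)
  have e2 := neg_sum_cellCoeff hz i 2 (by decide)
  simp only [derivValues, ← e1, ← e2, Matrix.cons_val]
  simp [affineMapDeriv, Matrix.toLin_finTwoProd_toContinuousLinearMap, cellMap]
  ring

/-! ### Derivative energies bounded by the energy of the hat function -/

lemma massForm_le (a b c : ℝ) : massForm a b c ≤ 2 * (a ^ 2 + b ^ 2 + c ^ 2) := by
  unfold massForm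
  nlinarith [sq_nonneg (a - b), sq_nonneg (b - c), sq_nonneg (c - a)]

/-- This and `massForm_le` reflect the identity `2 * massForm a b c = a² + b² + c² + (a + b + c)²`:
the eigenvalues of the form are 1/2, 1/2 and 2. -/
lemma le_massForm (a b c : ℝ) : (a ^ 2 + b ^ 2 + c ^ 2) / 2 ≤ massForm a b c := by
  unfold massForm
  nlinarith [sq_nonneg (a + b + c)]

lemma massForm_nonneg (a b c : ℝ) : 0 ≤ massForm a b c := by
  unfold massForm
  nlinarith [sq_nonneg (a + b), sq_nonneg (b + c), sq_nonneg (c + a)]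

lemma bary_le_one (hz : ∀ i, 0 < bary h₁ h₂ i z₀) (i : Fin 3) : bary h₁ h₂ i z₀ ≤ 1 := by
  linarith [sum_bary (h₁ := h₁) (h₂ := h₂) i z₀, hz (i + 1), hz (i + 2)]

/-- The size of the nonzero `k`-th derivatives of the barycentric coordinates. -/
noncomputable def slope (h₁ h₂ : ℝ) : Fin 3 → ℝ := ![1, h₁⁻¹, h₂⁻¹]

lemma slope_pos (hh₁ : 0 < h₁) (hh₂ : 0 < h₂) (k : Fin 3) : 0 < slope h₁ h₂ k := by
  fin_cases k <;> simp [slope, hh₁, hh₂]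

lemma baryCoeff_eq_zero_or (hh₁ : 0 < h₁) (hh₂ : 0 < h₂) (i : Fin 3) {k : Fin 3} (hk : k ≠ 0) :
    baryCoeff h₁ h₂ i k = 0 ∨ |baryCoeff h₁ h₂ i k| = slope h₁ h₂ k := by
  fin_cases k
  · exact absurd rfl hk
  all_goals fin_cases i <;> simp [baryCoeff, slope, hh₁.le, hh₂.le]

/-- The square of the `L²` norm of the `k`-th derivative of the hat function, up to scaling. -/
noncomputable def hatEnergy (h₁ h₂ : ℝ) (z₀ : ℝ × ℝ) (k : Fin 3) : ℝ :=
  ∑ i, baryCoeff h₁ h₂ i k ^ 2 / bary h₁ h₂ i z₀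

/-- In each direction exactly two of the three `λ_i` have a nonzero derivative, and `λ_i(z₀) ≤ 1`.
The bound absorbs the terms that carry no factor `1 / λ_i(z₀)`. -/
lemma two_mul_slope_sq_le_hatEnergy (hz : ∀ i, 0 < bary h₁ h₂ i z₀) {k : Fin 3} (hk : k ≠ 0) :
    2 * slope h₁ h₂ k ^ 2 ≤ hatEnergy h₁ h₂ z₀ k := by
  have h : ∀ (i : Fin 3) (c : ℝ), c ^ 2 ≤ c ^ 2 / bary h₁ h₂ i z₀ := fun i c =>
    le_div_self (sq_nonneg c) (hz i) (bary_le_one hz i)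
  rw [hatEnergy, Fin.sum_univ_three]
  fin_cases k
  · exact absurd rfl hk
  · have h1 := h 1 (h₁⁻¹)
    have h2 := h 2 (h₁⁻¹)
    simp [baryCoeff, slope] at h1 h2 ⊢
    linarith
  · have h1 := h 0 (h₂⁻¹)
    have h2 := h 2 (h₂⁻¹)
    simp [baryCoeff, slope] at h1 h2 ⊢
    linarith

/-- The energy of the hat function contains `1 / λ_i(z₀)` only for cells with `∂_k λ_i ≠ 0`, so the
case `∂_k λ_i = 0` needs a bound free of this factor. It exists, since the derivative then loses
every term divided by `λ_i(z₀)`. -/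
lemma massForm_derivValues_le (hh₁ : 0 < h₁) (hh₂ : 0 < h₂) (hz : ∀ i, 0 < bary h₁ h₂ i z₀)
    {k : Fin 3} (hk : k ≠ 0) {A t : ℝ} {B : Fin 3 → ℝ} (hA : |2 * A| ≤ 7 * t)
    (hB : ∀ j, |B j| ≤ 2 * t) (i : Fin 3) :
    bary h₁ h₂ i z₀ * massForm (derivValues h₁ h₂ z₀ k A B i 0) (derivValues h₁ h₂ z₀ k A B i 1)
      (derivValues h₁ h₂ z₀ k A B i 2)
      ≤ t ^ 2 * (258 * (baryCoeff h₁ h₂ i k ^ 2 / bary h₁ h₂ i z₀) + 16 * slope h₁ h₂ k ^ 2) := by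
  have ht : 0 ≤ t := by linarith [abs_nonneg (2 * A)]
  have hκ := slope_pos hh₁ hh₂ k
  have hp := hz i
  have hle : ∀ j, |baryCoeff h₁ h₂ j k| ≤ slope h₁ h₂ k := fun j => by
    rcases baryCoeff_eq_zero_or hh₁ hh₂ j hk with h | h
    · rw [h, abs_zero]; exact hκ.le
    · exact h.le
  have prod : ∀ {x y a b : ℝ}, |x| ≤ a → |y| ≤ b → |x * y| ≤ a * b := fun {x y a b} hx hy => by
    rw [abs_mul]
    exact mul_le_mul hx hy (abs_nonneg _) ((abs_nonneg _).trans hx)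
  rcases baryCoeff_eq_zero_or hh₁ hh₂ i hk with h | h
  · have e0 : derivValues h₁ h₂ z₀ k A B i 0 =
        B (i + 1) * baryCoeff h₁ h₂ (i + 1) k + B (i + 2) * baryCoeff h₁ h₂ (i + 2) k := by
      simp [derivValues, cellCoeff, h]
    have e1 : derivValues h₁ h₂ z₀ k A B i 1 = 0 := by simp [derivValues, h]
    have e2 : derivValues h₁ h₂ z₀ k A B i 2 = 0 := by simp [derivValues, h]
    have hV : |derivValues h₁ h₂ z₀ k A B i 0| ≤ 4 * t * slope h₁ h₂ k := by
      rw [e0]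
      refine (abs_add_le _ _).trans ?_
      linarith [prod (hB (i + 1)) (hle (i + 1)), prod (hB (i + 2)) (hle (i + 2))]
    have hsq := sq_le_sq' (abs_le.1 hV).1 (abs_le.1 hV).2
    rw [e1, e2, h]
    have hm : massForm (derivValues h₁ h₂ z₀ k A B i 0) 0 0 =
      derivValues h₁ h₂ z₀ k A B i 0 ^ 2 := by simp [massForm]
    rw [hm]
    calc _ ≤ 1 * derivValues h₁ h₂ z₀ k A B i 0 ^ 2 :=
          mul_le_mul_of_nonneg_right (bary_le_one hz i) (sq_nonneg _)
      _ ≤ _ := by rw [one_mul]; refine hsq.trans (le_of_eq ?_); ring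
  -- Multiplying by `λ_i(z₀)` clears the denominator and leaves two terms with weights `λ_i(z₀)` and
  -- `λ_j(z₀)`, of sum at most one.
  · have hc : ∀ j, bary h₁ h₂ i z₀ + bary h₁ h₂ j z₀ ≤ 1 →
        |bary h₁ h₂ i z₀ * cellCoeff h₁ h₂ z₀ i j k| ≤ slope h₁ h₂ k := fun j hj => by
      have : bary h₁ h₂ i z₀ * cellCoeff h₁ h₂ z₀ i j k =
          bary h₁ h₂ i z₀ * baryCoeff h₁ h₂ j k - bary h₁ h₂ j z₀ * baryCoeff h₁ h₂ i k := by
        rw [cellCoeff]; field_simp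
      rw [this]
      refine (abs_sub _ _).trans ?_
      have h1 := prod (abs_of_pos hp).le (hle j)
      have h2 := prod (abs_of_pos (hz j)).le (hle i)
      nlinarith
    have s0 := sum_bary (h₁ := h₁) (h₂ := h₂) i z₀
    have c1 := hc (i + 1) (by linarith [hz (i + 2)])
    have c2 := hc (i + 2) (by linarith [hz (i + 1)])
    have hg := h.le
    have v0 : |bary h₁ h₂ i z₀ * derivValues h₁ h₂ z₀ k A B i 0| ≤ 11 * t * slope h₁ h₂ k := by
      have : bary h₁ h₂ i z₀ * derivValues h₁ h₂ z₀ k A B i 0 = 2 * A * baryCoeff h₁ h₂ i k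
        + B (i + 1) * (bary h₁ h₂ i z₀ * cellCoeff h₁ h₂ z₀ i (i + 1) k)
        + B (i + 2) * (bary h₁ h₂ i z₀ * cellCoeff h₁ h₂ z₀ i (i + 2) k) := by
        simp only [derivValues, Matrix.cons_val]; field_simp
      rw [this]
      refine (abs_add_three _ _ _).trans ?_
      linarith [prod hA hg, prod (hB (i + 1)) c1, prod (hB (i + 2)) c2]
    have v1 : |bary h₁ h₂ i z₀ * derivValues h₁ h₂ z₀ k A B i 1| ≤ 2 * t * slope h₁ h₂ k := by
      have : bary h₁ h₂ i z₀ * derivValues h₁ h₂ z₀ k A B i 1 =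
          B (i + 1) * baryCoeff h₁ h₂ i k := by
        simp only [derivValues, Matrix.cons_val]; field_simp
      rw [this]
      exact prod (hB _) hg
    have v2 : |bary h₁ h₂ i z₀ * derivValues h₁ h₂ z₀ k A B i 2| ≤ 2 * t * slope h₁ h₂ k := by
      have : bary h₁ h₂ i z₀ * derivValues h₁ h₂ z₀ k A B i 2 =
          B (i + 2) * baryCoeff h₁ h₂ i k := by
        simp only [derivValues, Matrix.cons_val]; field_simp
      rw [this]
      exact prod (hB _) hg
    -- The bounds 11 = 7 + 2 + 2, 2 and 2 give 258 = 2 (11² + 2² + 2²), the leading 2 being that of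
    -- `massForm_le`.
    have q0 := sq_le_sq' (abs_le.1 v0).1 (abs_le.1 v0).2
    have q1 := sq_le_sq' (abs_le.1 v1).1 (abs_le.1 v1).2
    have q2 := sq_le_sq' (abs_le.1 v2).1 (abs_le.1 v2).2
    have hm := massForm_le (derivValues h₁ h₂ z₀ k A B i 0) (derivValues h₁ h₂ z₀ k A B i 1)
      (derivValues h₁ h₂ z₀ k A B i 2)
    rw [← sq_abs (baryCoeff h₁ h₂ i k), h]
    generalize massForm _ _ _ = M at *
    refine le_trans (b := t ^ 2 * (258 * (slope h₁ h₂ k ^ 2 / bary h₁ h₂ i z₀))) ?_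
      (mul_le_mul_of_nonneg_left (by linarith [sq_nonneg (slope h₁ h₂ k)]) (sq_nonneg t))
    rw [← mul_div_assoc, ← mul_div_assoc, le_div_iff₀ hp]
    have := mul_le_mul_of_nonneg_left hm (sq_nonneg (bary h₁ h₂ i z₀))
    linarith

lemma sum_massForm_derivValues_le (hh₁ : 0 < h₁) (hh₂ : 0 < h₂)
    (hz : ∀ i, 0 < bary h₁ h₂ i z₀)
    {k : Fin 3} (hk : k ≠ 0) {A t : ℝ} {B : Fin 3 → ℝ} (hA : |2 * A| ≤ 7 * t)
    (hB : ∀ j, |B j| ≤ 2 * t) :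
    ∑ i, bary h₁ h₂ i z₀ * massForm (derivValues h₁ h₂ z₀ k A B i 0)
      (derivValues h₁ h₂ z₀ k A B i 1) (derivValues h₁ h₂ z₀ k A B i 2)
      ≤ 282 * t ^ 2 * hatEnergy h₁ h₂ z₀ k := by
  refine (Finset.sum_le_sum fun i _ => massForm_derivValues_le hh₁ hh₂ hz hk hA hB i).trans ?_
  rw [← Finset.mul_sum, Finset.sum_add_distrib, ← Finset.mul_sum, ← hatEnergy]
  simp only [Finset.sum_const, Finset.card_univ, Fintype.card_fin, nsmul_eq_mul, Nat.cast_ofNat]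
  -- The three cells contribute 3 · 16 = 48 squared slopes, hence at most 24 hat energies, and 282 =
  -- 258 + 24.
  have := two_mul_slope_sq_le_hatEnergy (h₁ := h₁) (h₂ := h₂) hz hk
  nlinarith [sq_nonneg t]

/-! ### Recovering the coefficients from the divergence -/

/-- The vertex values of the divergence control the coefficients of the field. -/
lemma coefficients_le (hh₁ : 0 < h₁) (hh₂ : 0 < h₂) (hz : ∀ i, 0 < bary h₁ h₂ i z₀)
    {A₁ A₂ s : ℝ} {B₁ B₂ : Fin 3 → ℝ}
    (hD : ∀ i j, |bary h₁ h₂ i z₀ * (derivValues h₁ h₂ z₀ 1 A₁ B₁ i j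
      + derivValues h₁ h₂ z₀ 2 A₂ B₂ i j)| ≤ s) :
    (|2 * A₁| ≤ 7 * (h₁ * s) ∧ ∀ j, |B₁ j| ≤ 2 * (h₁ * s)) ∧
      (|2 * A₂| ≤ 7 * (h₂ * s) ∧ ∀ j, |B₂ j| ≤ 2 * (h₂ * s)) := by
  -- In these scaled unknowns `h₁` and `h₂` cancel from all the equations.
  obtain ⟨a₁, rfl⟩ : ∃ a, A₁ = h₁ * a := ⟨A₁ / h₁, by field_simp⟩
  obtain ⟨a₂, rfl⟩ : ∃ a, A₂ = h₂ * a := ⟨A₂ / h₂, by field_simp⟩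
  obtain ⟨b₁, rfl⟩ : ∃ b : Fin 3 → ℝ, B₁ = fun j => h₁ * b j :=
    ⟨fun j => B₁ j / h₁, by funext j; field_simp⟩
  obtain ⟨b₂, rfl⟩ : ∃ b : Fin 3 → ℝ, B₂ = fun j => h₂ * b j :=
    ⟨fun j => B₂ j / h₂, by funext j; field_simp⟩
  have z0 := hz 0
  have z1 := hz 1
  have z2 := hz 2
  have l0 := bary_le_one hz 0
  have l1 := bary_le_one hz 1
  have l2 := bary_le_one hz 2
  -- Six values at boundary vertices, two for each vertex, determine the edge coefficients. At `z₀`,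
  -- cells 0 and 1 suffice: `∇λ_0` and `∇λ_1` are parallel to the axes, so each isolates one
  -- component.
  have e01 := hD 0 1
  have e02 := hD 0 2
  have e11 := hD 1 1
  have e12 := hD 1 2
  have e21 := hD 2 1
  have e22 := hD 2 2
  have e00 := hD 0 0
  have e10 := hD 1 0
  simp only [derivValues, cellCoeff, baryCoeff, Matrix.cons_val, Fin.isValue, zero_add,
    Fin.reduceAdd] at e00 e01 e02 e10 e11 e12 e21 e22
  generalize bary h₁ h₂ 0 z₀ = α at *
  generalize bary h₁ h₂ 1 z₀ = β at *
  generalize bary h₁ h₂ 2 z₀ = γ at *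
  have s0 : 0 ≤ s := (abs_nonneg _).trans e01
  have f01 : |b₂ 1| ≤ s := by convert e01 using 2; field_simp; ring
  have f02 : |b₂ 2| ≤ s := by convert e02 using 2; field_simp; ring
  have f11 : |b₁ 2| ≤ s := by convert e11 using 2; field_simp; ring
  have f12 : |b₁ 0| ≤ s := by convert e12 using 2; field_simp; ring
  have f21 : |-b₁ 0 - b₂ 0| ≤ s := by convert e21 using 2; field_simp; ring
  have f22 : |-b₁ 1 - b₂ 1| ≤ s := by convert e22 using 2; field_simp; ring
  have f00 : |2 * a₂ + α * b₁ 1 - β * b₂ 1 - α * b₁ 2 - α * b₂ 2 - γ * b₂ 2| ≤ s := by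
    convert e00 using 2; field_simp; ring
  have f10 : |2 * a₁ - β * b₁ 2 - β * b₂ 2 - γ * b₁ 2 - α * b₁ 0 + β * b₂ 0| ≤ s := by
    convert e10 using 2; field_simp; ring
  -- At vertices 0 and 1 one component is known directly and only the sum of both from cell 2, so
  -- the other one costs a factor 2.
  have g11 : |b₁ 1| ≤ 2 * s := by
    rw [abs_le] at *
    constructor <;> linarith
  have g20 : |b₂ 0| ≤ 2 * s := by
    rw [abs_le] at *
    constructor <;> linarith
  have prod : ∀ {c x y : ℝ}, 0 < c → c ≤ 1 → |x| ≤ y → |c * x| ≤ y := fun {c x y} h0 h1 hx => by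
    rw [abs_mul, abs_of_pos h0]
    nlinarith [abs_nonneg x]
  have p1 := abs_le.1 (prod z0 l0 g11)
  have p2 := abs_le.1 (prod z1 l1 f01)
  have p3 := abs_le.1 (prod z0 l0 f11)
  have p4 := abs_le.1 (prod z0 l0 f02)
  have p5 := abs_le.1 (prod z2 l2 f02)
  have r1 := abs_le.1 (prod z1 l1 f11)
  have r2 := abs_le.1 (prod z1 l1 f02)
  have r3 := abs_le.1 (prod z2 l2 f11)
  have r4 := abs_le.1 (prod z0 l0 f12)
  have r5 := abs_le.1 (prod z1 l1 g20)
  -- Seven is one for the divergence value, two for the coefficient bounded by `2 * s`, and four for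
  -- the remaining terms.
  have ga₂ : |2 * a₂| ≤ 7 * s := by
    rw [abs_le] at f00 ⊢
    constructor <;> linarith
  have ga₁ : |2 * a₁| ≤ 7 * s := by
    rw [abs_le] at f10 ⊢
    constructor <;> linarith
  have gb₁ : ∀ j, |b₁ j| ≤ 2 * s := by
    intro j
    fin_cases j <;> simp only [Fin.zero_eta, Fin.mk_one, Fin.reduceFinMk] <;> linarith
  have gb₂ : ∀ j, |b₂ j| ≤ 2 * s := by
    intro j
    fin_cases j <;> simp only [Fin.zero_eta, Fin.mk_one, Fin.reduceFinMk] <;> linarith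
  have scale : ∀ {h x c : ℝ}, 0 < h → |x| ≤ c * s → |h * x| ≤ c * (h * s) :=
    fun {h x c} h0 hx => by
      rw [abs_mul, abs_of_pos h0]
      nlinarith
  refine ⟨⟨?_, fun j => scale hh₁ (gb₁ j)⟩, ⟨?_, fun j => scale hh₂ (gb₂ j)⟩⟩
  · rw [mul_left_comm]; exact scale hh₁ ga₁
  · rw [mul_left_comm]; exact scale hh₂ ga₂

/-! ### Energies and the stability estimate -/

/-- The squared `L²` norm, up to scaling, of the function with vertex values `V`. -/
noncomputable def vertexEnergy (h₁ h₂ : ℝ) (z₀ : ℝ × ℝ) (V : Fin 3 → Fin 3 → ℝ) : ℝ :=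
  ∑ i, bary h₁ h₂ i z₀ * massForm (V i 0) (V i 1) (V i 2)

lemma vertexEnergy_nonneg (hz : ∀ i, 0 < bary h₁ h₂ i z₀) (V : Fin 3 → Fin 3 → ℝ) :
    0 ≤ vertexEnergy h₁ h₂ z₀ V :=
  Finset.sum_nonneg fun i _ => mul_nonneg (hz i).le (massForm_nonneg _ _ _)

/-- The energy weights `V i j ^ 2` by `λ_i(z₀)`, which dominates `λ_i(z₀)²`. The weaker weight
suffices, because the equations for the coefficients are those for `λ_i(z₀)` times the divergence.
-/
lemma sq_le_vertexEnergy (hz : ∀ i, 0 < bary h₁ h₂ i z₀) (V : Fin 3 → Fin 3 → ℝ) (i j : Fin 3) :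
    (bary h₁ h₂ i z₀ * V i j) ^ 2 ≤ 2 * vertexEnergy h₁ h₂ z₀ V := by
  have h1 : bary h₁ h₂ i z₀ * massForm (V i 0) (V i 1) (V i 2) ≤ vertexEnergy h₁ h₂ z₀ V :=
    Finset.single_le_sum (f := fun i => bary h₁ h₂ i z₀ * massForm (V i 0) (V i 1) (V i 2))
      (fun i _ => mul_nonneg (hz i).le (massForm_nonneg _ _ _)) (Finset.mem_univ i)
  have h2 := le_massForm (V i 0) (V i 1) (V i 2)
  have h3 : V i j ^ 2 ≤ V i 0 ^ 2 + V i 1 ^ 2 + V i 2 ^ 2 := by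
    have a := sq_nonneg (V i 0)
    have b := sq_nonneg (V i 1)
    have c := sq_nonneg (V i 2)
    fin_cases j <;> simp only [Fin.zero_eta, Fin.mk_one, Fin.reduceFinMk] <;> linarith
  have h4 := mul_le_mul_of_nonneg_left (h3.trans (by linarith : _ ≤ 2 * massForm _ _ _)) (hz i).le
  have h5 := mul_le_mul_of_nonneg_right (bary_le_one hz i)
    (mul_nonneg (hz i).le (sq_nonneg (V i j)))
  nlinarith

lemma hasVertexValues_dx (hh₁ : 0 < h₁) (hh₂ : 0 < h₂) (hz : ∀ i, 0 < bary h₁ h₂ i z₀)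
    {f : ℝ × ℝ → ℝ} (hf : f ∈ scalarSpace 2 (refVertices h₁ h₂) z₀) :
    HasVertexValues h₁ h₂ z₀ (dx f)
      (derivValues h₁ h₂ z₀ 1 (f z₀) (edgeCoeff h₁ h₂ z₀ f)) := fun i x hx => by
  rw [dx, fderiv_on_openCell hh₁ hh₂ hz hf i hx]
  ring

lemma hasVertexValues_dy (hh₁ : 0 < h₁) (hh₂ : 0 < h₂) (hz : ∀ i, 0 < bary h₁ h₂ i z₀)
    {f : ℝ × ℝ → ℝ} (hf : f ∈ scalarSpace 2 (refVertices h₁ h₂) z₀) :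
    HasVertexValues h₁ h₂ z₀ (dy f)
      (derivValues h₁ h₂ z₀ 2 (f z₀) (edgeCoeff h₁ h₂ z₀ f)) := fun i x hx => by
  rw [dy, fderiv_on_openCell hh₁ hh₂ hz hf i hx]
  ring

lemma HasVertexValues.add {F G : ℝ × ℝ → ℝ} {V W : Fin 3 → Fin 3 → ℝ}
    (hF : HasVertexValues h₁ h₂ z₀ F V) (hG : HasVertexValues h₁ h₂ z₀ G W) :
    HasVertexValues h₁ h₂ z₀ (fun x => F x + G x) (fun i j => V i j + W i j) := fun i x hx => by
  simp only [hF i x hx, hG i x hx]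
  ring

lemma h1Seminorm_sq (hh₁ : 0 < h₁) (hh₂ : 0 < h₂) (hz : ∀ i, 0 < bary h₁ h₂ i z₀)
    {f : ℝ × ℝ → ℝ} (hf : f ∈ scalarSpace 2 (refVertices h₁ h₂) z₀) :
    h1Seminorm (refDomain h₁ h₂) f ^ 2 = h₁ * h₂ / 12 *
      (vertexEnergy h₁ h₂ z₀ (derivValues h₁ h₂ z₀ 1 (f z₀) (edgeCoeff h₁ h₂ z₀ f))
        + vertexEnergy h₁ h₂ z₀ (derivValues h₁ h₂ z₀ 2 (f z₀) (edgeCoeff h₁ h₂ z₀ f))) := by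
  have hx := hasVertexValues_dx hh₁ hh₂ hz hf
  have hy := hasVertexValues_dy hh₁ hh₂ hz hf
  rw [h1Seminorm, Real.sq_sqrt (integral_nonneg fun x => by positivity),
    integral_add (hx.integrableOn hh₁ hh₂ hz) (hy.integrableOn hh₁ hh₂ hz),
    hx.integral_sq hh₁ hh₂ hz, hy.integral_sq hh₁ hh₂ hz, mul_add]
  rfl

/-- The gradient of the hat function is constant on each cell, so the three vertex values agree and
`massForm c c c = 6 * c ^ 2`. -/
lemma h1Seminorm_hat_sq (hh₁ : 0 < h₁) (hh₂ : 0 < h₂) (hz : ∀ i, 0 < bary h₁ h₂ i z₀)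
    {μ : ℝ × ℝ → ℝ} (hμ : IsHatFunction (refVertices h₁ h₂) z₀ μ) :
    h1Seminorm (refDomain h₁ h₂) μ ^ 2 = h₁ * h₂ / 2 *
      (hatEnergy h₁ h₂ z₀ 1 + hatEnergy h₁ h₂ z₀ 2) := by
  have key : ∀ k : Fin 3, k ≠ 0 → vertexEnergy h₁ h₂ z₀
      (derivValues h₁ h₂ z₀ k (μ z₀) (edgeCoeff h₁ h₂ z₀ μ)) = 6 * hatEnergy h₁ h₂ z₀ k := by
    intro k hk
    rw [vertexEnergy, hatEnergy, Finset.mul_sum]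
    refine Finset.sum_congr rfl fun i _ => ?_
    have h := neg_sum_cellCoeff hz i k hk
    have hp := (hz i).ne'
    simp only [derivValues, edgeCoeff_hat hh₁ hh₂ hμ, hμ.2, Matrix.cons_val, massForm]
    rw [show cellCoeff h₁ h₂ z₀ i (i + 1) k =
      -cellCoeff h₁ h₂ z₀ i (i + 2) k - baryCoeff h₁ h₂ i k / bary h₁ h₂ i z₀ by rw [← h]; ring]
    field_simp
    ring
  rw [h1Seminorm_sq hh₁ hh₂ hz (scalarSpace_mono one_le_two hμ.1), key 1 (by decide),
    key 2 (by decide)]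
  ring

lemma h1SeminormVec_sq_le (hh₁ : 0 < h₁) (hh : h₁ ≤ h₂) (hz : ∀ i, 0 < bary h₁ h₂ i z₀)
    {μ : ℝ × ℝ → ℝ} (hμ : IsHatFunction (refVertices h₁ h₂) z₀ μ) {w : ℝ × ℝ → ℝ × ℝ}
    (hw : w ∈ vectorSpace 2 (refVertices h₁ h₂) z₀) :
    h1SeminormVec (refDomain h₁ h₂) w ^ 2 ≤ 2256 * (h₂ / h₁) *
      h1Seminorm (refDomain h₁ h₂) μ ^ 2 * l2Norm (refDomain h₁ h₂) (divergence w) ^ 2 := by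
  have hh₂ := hh₁.trans_le hh
  obtain ⟨hw₁, hw₂⟩ := hw
  obtain ⟨V, hV⟩ : ∃ V : Fin 3 → Fin 3 → ℝ, V = fun i j =>
    derivValues h₁ h₂ z₀ 1 ((w z₀).1) (edgeCoeff h₁ h₂ z₀ fun x => (w x).1) i j +
    derivValues h₁ h₂ z₀ 2 ((w z₀).2) (edgeCoeff h₁ h₂ z₀ fun x => (w x).2) i j := ⟨_, rfl⟩
  have hdiv : HasVertexValues h₁ h₂ z₀ (divergence w) V := hV ▸
    (hasVertexValues_dx hh₁ hh₂ hz hw₁).add (hasVertexValues_dy hh₁ hh₂ hz hw₂)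
  have hl2 : l2Norm (refDomain h₁ h₂) (divergence w) ^ 2 =
      h₁ * h₂ / 12 * vertexEnergy h₁ h₂ z₀ V := by
    rw [l2Norm, Real.sq_sqrt (integral_nonneg fun x => by positivity),
      hdiv.integral_sq hh₁ hh₂ hz, ← vertexEnergy]
  rw [h1SeminormVec, Real.sq_sqrt (by positivity), h1Seminorm_sq hh₁ hh₂ hz hw₁,
    h1Seminorm_sq hh₁ hh₂ hz hw₂, h1Seminorm_hat_sq hh₁ hh₂ hz hμ, hl2]
  have hN := vertexEnergy_nonneg hz V
  obtain ⟨⟨hA₁, hB₁⟩, hA₂, hB₂⟩ := coefficients_le hh₁ hh₂ hz (s := √(2 * vertexEnergy h₁ h₂ z₀ V))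
    (fun i j => Real.abs_le_sqrt (by simpa only [hV] using sq_le_vertexEnergy hz V i j))
  generalize vertexEnergy h₁ h₂ z₀ V = N at *
  have hs : Real.sqrt (2 * N) ^ 2 = 2 * N := Real.sq_sqrt (by linarith)
  have k11 := sum_massForm_derivValues_le hh₁ hh₂ hz (k := 1) (by decide) hA₁ hB₁
  have k12 := sum_massForm_derivValues_le hh₁ hh₂ hz (k := 2) (by decide) hA₁ hB₁
  have k21 := sum_massForm_derivValues_le hh₁ hh₂ hz (k := 1) (by decide) hA₂ hB₂
  have k22 := sum_massForm_derivValues_le hh₁ hh₂ hz (k := 2) (by decide) hA₂ hB₂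
  rw [← vertexEnergy, mul_pow, hs] at k11 k12 k21 k22
  have hH : ∀ k, 0 ≤ hatEnergy h₁ h₂ z₀ k := fun k =>
    Finset.sum_nonneg fun i _ => div_nonneg (sq_nonneg _) (hz i).le
  have hH1 := hH 1
  have hH2 := hH 2
  generalize hatEnergy h₁ h₂ z₀ 1 = H₁ at *
  generalize hatEnergy h₁ h₂ z₀ 2 = H₂ at *
  have hsq : h₁ ^ 2 ≤ h₂ ^ 2 := pow_le_pow_left₀ hh₁.le hh 2
  have hNH : h₁ ^ 2 * (N * (H₁ + H₂)) ≤ h₂ ^ 2 * (N * (H₁ + H₂)) :=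
    mul_le_mul_of_nonneg_right hsq (mul_nonneg hN (add_nonneg hH1 hH2))
  -- The four energy bounds add up to `564 (h₁² + h₂²) N (H₁ + H₂)`, where 564 = 2 · 282 comes from
  -- `s² = 2 * N`. Then `h₁ ≤ h₂` yields 1128, and 2256 compensates the 1/2 in the energy of the hat
  -- function.
  rw [← mul_add, show 2256 * (h₂ / h₁) * (h₁ * h₂ / 2 * (H₁ + H₂)) * (h₁ * h₂ / 12 * N) =
    h₁ * h₂ / 12 * (1128 * h₂ ^ 2 * (N * (H₁ + H₂))) by field_simp; ring]
  refine mul_le_mul_of_nonneg_left ?_ (by positivity)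
  simp only [vertexEnergy] at k11 k12 k21 k22 ⊢
  linarith

/-! ### Existence of the largest stability constant -/

lemma zero_mem_scalarSpace {z : Fin 3 → ℝ × ℝ} (k : ℕ) : (fun _ => 0) ∈ scalarSpace k z z₀ :=
  ⟨continuousOn_const, fun _ _ => rfl, fun _ => ⟨0, by simp, by simp⟩⟩

/-- The field whose first component is the hat function and whose second component vanishes. -/
def hatField {z : Fin 3 → ℝ × ℝ} {μ : ℝ × ℝ → ℝ} (hμ : IsHatFunction z z₀ μ) :
    vectorSpace 2 z z₀ :=
  ⟨fun x => (μ x, 0), scalarSpace_mono one_le_two hμ.1, zero_mem_scalarSpace 2⟩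

lemma h1SeminormVec_hatField_pos (hh₁ : 0 < h₁) (hh₂ : 0 < h₂) (hz : ∀ i, 0 < bary h₁ h₂ i z₀)
    {μ : ℝ × ℝ → ℝ} (hμ : IsHatFunction (refVertices h₁ h₂) z₀ μ) :
    0 < h1SeminormVec (refDomain h₁ h₂) (hatField hμ).1 := by
  refine Real.sqrt_pos.2 (add_pos_of_pos_of_nonneg ?_ (sq_nonneg _))
  have h : 0 < h1Seminorm (refDomain h₁ h₂) μ ^ 2 := by
    rw [h1Seminorm_hat_sq hh₁ hh₂ hz hμ]
    have hpos : ∀ k : Fin 3, k ≠ 0 → 0 < hatEnergy h₁ h₂ z₀ k := fun k hk =>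
      lt_of_lt_of_le (by have := slope_pos hh₁ hh₂ k; positivity)
        (two_mul_slope_sq_le_hatEnergy hz hk)
    have := hpos 1 (by decide)
    have := hpos 2 (by decide)
    positivity
  exact h

/-- An index with `p i > 0` bounds the admissible `b` by `d i / p i`, so the supremum is finite.
Each constraint `b * p i ≤ d i` is closed in `b` and thus survives the passage to the supremum. -/
lemma isGreatest_sSup_of_bounds {ι : Type*} {p d : ι → ℝ} (hne : ∃ b > 0, ∀ i, p i ≤ b⁻¹ * d i)
    (hp : ∃ i, 0 < p i) :
    IsGreatest {b | 0 < b ∧ ∀ i, p i ≤ b⁻¹ * d i} (sSup {b | 0 < b ∧ ∀ i, p i ≤ b⁻¹ * d i}) := by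
  set S := {b | 0 < b ∧ ∀ i, p i ≤ b⁻¹ * d i}
  have hle : ∀ b ∈ S, ∀ i, 0 < p i → b ≤ d i / p i := fun b hb i hi => by
    rw [le_div_iff₀ hi]
    have := hb.2 i
    rwa [inv_mul_eq_div, le_div_iff₀' hb.1] at this
  obtain ⟨b, hb⟩ : S.Nonempty := hne
  obtain ⟨i, hi⟩ := hp
  have hbdd : BddAbove S := ⟨_, fun c hc => hle c hc i hi⟩
  have hpos : 0 < sSup S := hb.1.trans_le (le_csSup hbdd hb)
  refine ⟨⟨hpos, fun j => ?_⟩, fun c hc => le_csSup hbdd hc⟩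
  rw [inv_mul_eq_div, le_div_iff₀' hpos]
  rcases lt_or_ge 0 (p j) with hj | hj
  · rw [← le_div_iff₀ hj]
    exact csSup_le ⟨b, hb⟩ fun c hc => hle c hc j hj
  -- For `p j ≤ 0`, enlarging `b` only decreases `b * p j`, so one admissible `b` is enough.
  · have h1 := hb.2 j
    rw [inv_mul_eq_div, le_div_iff₀' hb.1] at h1
    exact le_trans (mul_le_mul_of_nonpos_right (le_csSup hbdd hb) hj) h1

end CloughTocher

theorem mainTheorem2 :
    ∃ C > (0 : ℝ), ∃ c > (0 : ℝ), ∀ h₁ h₂ : ℝ, 0 < h₁ → h₁ ≤ h₂ →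
      ∀ z₀ ∈ CloughTocher.refDomain h₁ h₂,
      ∀ μ : ℝ × ℝ → ℝ, CloughTocher.IsHatFunction (CloughTocher.refVertices h₁ h₂) z₀ μ →
        (∀ w ∈ CloughTocher.vectorSpace 2 (CloughTocher.refVertices h₁ h₂) z₀,
          CloughTocher.h1SeminormVec (CloughTocher.refDomain h₁ h₂) w ≤
            C * Real.sqrt (h₂ / h₁) *
              (1 + CloughTocher.h1Seminorm (CloughTocher.refDomain h₁ h₂) μ) *
              CloughTocher.l2Norm (CloughTocher.refDomain h₁ h₂) (CloughTocher.divergence w)) ∧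
        IsGreatest (CloughTocher.stabilityConstants (CloughTocher.refVertices h₁ h₂) z₀)
          (CloughTocher.localInfSup (CloughTocher.refVertices h₁ h₂) z₀) ∧
        c * (Real.sqrt (h₂ / h₁) *
            (1 + CloughTocher.h1Seminorm (CloughTocher.refDomain h₁ h₂) μ))⁻¹ ≤
          CloughTocher.localInfSup (CloughTocher.refVertices h₁ h₂) z₀ := by
  -- The squared estimate has the constant 2256, and 48² = 2304.
  refine ⟨48, by norm_num, 48⁻¹, by norm_num, fun h₁ h₂ hh₁ hh z₀ hz₀ μ hμ => ?_⟩
  have hh₂ := hh₁.trans_le hh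
  have hz : ∀ i, 0 < CloughTocher.bary h₁ h₂ i z₀ := by
    rwa [CloughTocher.refDomain_eq hh₁ hh₂] at hz₀
  have hμ0 : 0 ≤ CloughTocher.h1Seminorm (CloughTocher.refDomain h₁ h₂) μ := Real.sqrt_nonneg _
  have hbound : ∀ w ∈ CloughTocher.vectorSpace 2 (CloughTocher.refVertices h₁ h₂) z₀,
      CloughTocher.h1SeminormVec (CloughTocher.refDomain h₁ h₂) w ≤
        48 * Real.sqrt (h₂ / h₁) *
          (1 + CloughTocher.h1Seminorm (CloughTocher.refDomain h₁ h₂) μ) *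
          CloughTocher.l2Norm (CloughTocher.refDomain h₁ h₂) (CloughTocher.divergence w) := by
    intro w hw
    have hd : 0 ≤ CloughTocher.l2Norm (CloughTocher.refDomain h₁ h₂)
      (CloughTocher.divergence w) := Real.sqrt_nonneg _
    refine le_trans (b := 48 * Real.sqrt (h₂ / h₁) *
      CloughTocher.h1Seminorm (CloughTocher.refDomain h₁ h₂) μ *
      CloughTocher.l2Norm (CloughTocher.refDomain h₁ h₂) (CloughTocher.divergence w))
      (abs_le_of_sq_le_sq' ?_ (by positivity)).2 (by gcongr; linarith)
    refine (CloughTocher.h1SeminormVec_sq_le hh₁ hh hz hμ hw).trans ?_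
    rw [mul_pow, mul_pow, mul_pow, Real.sq_sqrt (by positivity)]
    gcongr
    norm_num
  have hK : 0 < Real.sqrt (h₂ / h₁) *
      (1 + CloughTocher.h1Seminorm (CloughTocher.refDomain h₁ h₂) μ) := by positivity
  have hmem : 48⁻¹ * (Real.sqrt (h₂ / h₁) *
      (1 + CloughTocher.h1Seminorm (CloughTocher.refDomain h₁ h₂) μ))⁻¹ ∈
      CloughTocher.stabilityConstants (CloughTocher.refVertices h₁ h₂) z₀ := by
    refine ⟨by positivity, fun w hw => ?_⟩
    rw [mul_inv, inv_inv, inv_inv, ← mul_assoc]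
    exact hbound w hw
  have hgreat : IsGreatest (CloughTocher.stabilityConstants (CloughTocher.refVertices h₁ h₂) z₀)
      (CloughTocher.localInfSup (CloughTocher.refVertices h₁ h₂) z₀) := by
    have hset : CloughTocher.stabilityConstants (CloughTocher.refVertices h₁ h₂) z₀ =
        {b | 0 < b ∧ ∀ w : CloughTocher.vectorSpace 2 (CloughTocher.refVertices h₁ h₂) z₀,
          CloughTocher.h1SeminormVec (CloughTocher.refDomain h₁ h₂) w ≤ b⁻¹ *
            CloughTocher.l2Norm (CloughTocher.refDomain h₁ h₂)
              (CloughTocher.divergence w)} := by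
      ext b
      simp only [Subtype.forall]
      rfl
    rw [CloughTocher.localInfSup, hset]
    rw [hset] at hmem
    exact CloughTocher.isGreatest_sSup_of_bounds ⟨_, hmem⟩
      ⟨CloughTocher.hatField hμ, CloughTocher.h1SeminormVec_hatField_pos hh₁ hh₂ hz hμ⟩
  exact ⟨hbound, hgreat, hgreat.2 hmem⟩
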